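/- There is a universal constant $C>0$ such that the following holds. Let $(\mathbb B,\|\cdot\|)$ be a real Banach space (if $\mathbb B$ is not separable, measurability of $\mathbb B$-valued maps is understood in the strong, Bochner sense), and let $P$ be a Borel probability measure on $\mathbb B$ with $\mathbb E_{W\sim P}\|W\|^2<\infty$. Put $$\theta=\mathbb E_{W\sim P}[W],\qquad V=\mathbb E_{W\sim P}\|W-\theta\|^2,\qquad \nu=\sup_{\|u\|_*\le 1}\mathbb E_{W\sim P}|\langle W-\theta,u\rangle|^2 .$$ Let $n\ge 1$, $N=2n$, and let $W_1,\dots,W_{2n}$ be i.i.d. with law $P$, split into $\mathcal S_1=(W_1,\dots,W_n)$ and $\mathcal S_2=(W_{n+1},\dots,W_{2n})$. Let the pilots $\hat\theta_{\mathcal S_1}$, $\hat\theta_{\mathcal S_2}$ be measurable functions of $\mathcal S_1$ and of $\mathcal S_2$ respectively, with values in $\mathbb B$. Let $\alpha\ge 1$, $R>0$, $r_n>0$, and let $U\subseteq\mathbb B$ contain the closed ball $B(\theta,r_n)=\{x:\|x-\theta\|\le r_n\}$. Let $f:\mathbb B\to\mathbb R$ be infinitely Fréchet differentiable at every point of $U$,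 with $$\|f\|_{\mathcal G^\alpha(U),R}:=\sup_{x\in U}\sup_{k\ge 0}\frac{\|\mathcal D^kf(x)\|_{\rm S}}{R^k(k!)^\alpha}<\infty ,$$ where $\|\cdot\|_{\rm S}$ is the operator norm of multilinear forms (so $f$ is in the Gevrey class $\mathcal G^\alpha(U)$). For a sample $\mathcal S=(w_1,\dots,w_n)$, $s\ge 0$ and $t\in\mathbb B$ set $$\widehat f_s(\mathcal S;t)=f(t)+\sum_{k=1}^{s}\frac1{k!}\binom nk^{-1}\sum_{1\le j_1<\dots<j_k\le n}\mathcal D^kf(t)[w_{j_1}-t,\dots,w_{j_k}-t],$$ and let $$\widehat f_s=\tfrac12\big(\widehat f_s(\mathcal S_1;\hat\theta_{\mathcal S_2})+\widehat f_s(\mathcal S_2;\hat\theta_{\mathcal S_1})\big),\qquad s=\lfloor\log(en)\rfloor .$$ Let $\bar W_N=N^{-1}\sum_{i=1}^N W_i$ and $\mathcal E=\{\max(\|\hat\theta_{\mathcal S_1}-\theta\|,\|\hat\theta_{\mathcal S_2}-\theta\|)\le r_n\}$. If $$R\,r_n\log^{\alpha-1}(en)\ \vee\ R\log^{\alpha}(en)\sqrt{V/n}\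 \le\ e^{-1},$$ then both expectations below are finite and $$\mathbb E^{1/2}\Big[|\widehat f_s-f(\theta)|^2\mathbf 1_{\mathcal E}\Big]\le C\,2^\alpha(R\vee R^2)\,\|f\|_{\mathcal G^\alpha(U),R}\Big(\sqrt{\frac{\nu}{n}}+\frac{r_n}{n}\Big),$$ $$\mathbb E^{1/2}\Big[N\big(\widehat f_s-f(\theta)-\mathcal D^1f(\theta)[\bar W_N-\theta]\big)^2\mathbf 1_{\mathcal E}\Big]\le C\,2^\alpha(R\vee R^2)\,\|f\|_{\mathcal G^\alpha(U),R}\Big(\sqrt{\frac{\nu V}{n}}+\frac{r_n}{\sqrt n}+\frac{\sqrt\nu}{n^{3/4}}\Big).$$ -/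

import Mathlib

open MeasureTheory ProbabilityTheory

noncomputable section

namespace GevreyEst

/-- The mean `θ(P) = E_{W ∼ P}[W]`, a Bochner integral. -/
def mean {B : Type*} [NormedAddCommGroup B] [NormedSpace ℝ B] [MeasurableSpace B]
    (P : Measure B) : B :=
  ∫ w, w ∂P

/-- The strong variance `V(P) = E ‖W - θ(P)‖²`. -/
def strongVar {B : Type*} [NormedAddCommGroup B] [NormedSpace ℝ B] [MeasurableSpace B]
    (P : Measure B) : ℝ :=
  ∫ w, ‖w - mean P‖ ^ 2 ∂P

/-- The weak variance `ν(P) = sup_{‖u‖_* ≤ 1} E |⟨W - θ(P), u⟩|²`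
(a supremum of a set of reals bounded by `V(P)` when `P` has a finite second moment). -/
def weakVar {B : Type*} [NormedAddCommGroup B] [NormedSpace ℝ B] [MeasurableSpace B]
    (P : Measure B) : ℝ :=
  ⨆ u : {u : StrongDual ℝ B // ‖u‖ ≤ 1}, ∫ w, |u.1 (w - mean P)| ^ 2 ∂P

/-- The Gevrey semi-norm `sup_{x ∈ U} sup_{k ≥ 0} ‖D^k f(x)‖ / (R^k (k!)^α)`, with values
in `[0, ∞]`. -/
def gevreyNorm {B : Type*} [NormedAddCommGroup B] [NormedSpace ℝ B]
    (α R : ℝ) (U : Set B) (f : B → ℝ) : ENNReal :=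
  ⨆ x ∈ U, ⨆ k : ℕ,
    ENNReal.ofReal (‖iteratedFDeriv ℝ k f x‖ / (R ^ k * (k.factorial : ℝ) ^ α))

/-- `f` is infinitely Fréchet differentiable at each point of `U` (for open `U` this is
`ContDiffOn ℝ ∞ f U`); the values of `f` away from `U` are arbitrary. -/
def SmoothOn {B : Type*} [NormedAddCommGroup B] [NormedSpace ℝ B]
    (U : Set B) (f : B → ℝ) : Prop :=
  ∀ x ∈ U, ContDiffAt ℝ ((⊤ : ℕ∞) : WithTop ℕ∞) f x

/-- The Gevrey class of order `α` on `U`. -/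
def gevreyClass {B : Type*} [NormedAddCommGroup B] [NormedSpace ℝ B]
    (α : ℝ) (U : Set B) : Set (B → ℝ) :=
  {f | SmoothOn U f ∧ ∃ R : ℝ, 0 < R ∧ gevreyNorm α R U f < ⊤}

/-- `T[Ū^{(k)}(b)]`: the average of `T[w_{j₁} - b, …, w_{j_k} - b]` over all
`j₁ < ⋯ < j_k`, for a sample `w` of size `n`. -/
def uStat {B : Type*} [NormedAddCommGroup B] [NormedSpace ℝ B] {n k : ℕ}
    (T : ContinuousMultilinearMap ℝ (fun _ : Fin k => B) ℝ) (w : Fin n → B) (b : B) : ℝ :=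
  ((n.choose k : ℕ) : ℝ)⁻¹ * ∑ j : Fin k ↪o Fin n, T (fun i => w (j i) - b)

/-- The one-sided estimator with U-statistics computed from the sample `w` and
pilot value `t`: `f(t) + ∑_{k=1}^s D^k f(t)[Ū^{(k)}(t)] / k!`. -/
def oneSided {B : Type*} [NormedAddCommGroup B] [NormedSpace ℝ B] {n : ℕ}
    (f : B → ℝ) (s : ℕ) (w : Fin n → B) (t : B) : ℝ :=
  f t + ∑ k ∈ Finset.Icc 1 s, uStat (iteratedFDeriv ℝ k f t) w t / (k.factorial : ℝ)

/-- First half `(w₁, …, w_n)` of a sample of size `2n`. -/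
def firstHalf {B : Type*} {n : ℕ} (w : Fin (n + n) → B) : Fin n → B :=
  fun i => w (Fin.castAdd n i)

/-- Second half `(w_{n+1}, …, w_{2n})` of a sample of size `2n`. -/
def secondHalf {B : Type*} {n : ℕ} (w : Fin (n + n) → B) : Fin n → B :=
  fun i => w (Fin.natAdd n i)

/-- The cross-fitted estimator, with pilot `g₁` computed from the first half and pilot `g₂`
computed from the second half. -/
def crossFit {B : Type*} [NormedAddCommGroup B] [NormedSpace ℝ B] {n : ℕ}
    (f : B → ℝ) (s : ℕ) (g₁ g₂ : (Fin n → B) → B) (w : Fin (n + n) → B) : ℝ :=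
  (oneSided f s (firstHalf w) (g₂ (secondHalf w)) +
    oneSided f s (secondHalf w) (g₁ (firstHalf w))) / 2

/-- The full sample average. -/
def sampleMean {B : Type*} [NormedAddCommGroup B] [NormedSpace ℝ B] {N : ℕ}
    (w : Fin N → B) : B :=
  (N : ℝ)⁻¹ • ∑ i, w i

/-- The truncation level `⌊log(en)⌋`. -/
def truncLevel (n : ℕ) : ℕ := ⌊Real.log (Real.exp 1 * n)⌋₊

/-- The event that both pilots are within distance `r` of `θ`. -/
def pilotEvent {Ω B : Type*} [NormedAddCommGroup B] {n : ℕ}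
    (g₁ g₂ : (Fin n → B) → B) (W : Fin (n + n) → Ω → B) (θ : B) (r : ℝ) : Set Ω :=
  {ω | max ‖g₁ (firstHalf fun i => W i ω) - θ‖ ‖g₂ (secondHalf fun i => W i ω) - θ‖ ≤ r}

end GevreyEst

end

/-! Freeze the pilot at a value `t` with `‖t - θ‖ ≤ r`. Expanding `D^k f(t)[w_j - t]` multilinearly
around `θ` and collecting terms rewrites the one-sided estimator as `∑_l T_l[Ū^(l)(θ)] / l!`, where
`T_l` is the Taylor polynomial, started at `t` and truncated at total order `s`, of `D^l f` at `θ`.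

For `l ∈ {0, 1}`, the form `T_l` differs from `D^l f(θ)` by a Taylor remainder, which
`R r log^(α-1)(en) ≤ 1/e` makes of order `(s + 1)^l e^(-s)`, and `e^(-s) ≤ 1/n` since
`s = ⌊log(en)⌋`.

For `l ≥ 2`, the summands of a centred U-statistic attached to distinct index sets are orthogonal
in `L²`, and each has second moment at most `‖T_l‖² ν V^(l-1)`, the weak variance coming from one
coordinate integrated with the others fixed. Hence `T_l[Ū^(l)(θ)]` has `L²` norm at most
`‖T_l‖ √(ν V^(l-1) / C(n, l))`, and the condition on `R log^α(en) √(V/n)` makes these bounds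
summable like a geometric series.

A random pilot is independent of the sample it is combined with, so by Fubini it may be treated as
frozen; averaging the two halves concludes.
-/

namespace GevreyEst

/-- Invariance of a multilinear map under permutations of its arguments. -/
def IsSymm {E F : Type*} [NormedAddCommGroup E] [NormedSpace ℝ E] [NormedAddCommGroup F]
    [NormedSpace ℝ F] {k : ℕ} (T : E [×k]→L[ℝ] F) : Prop :=
  ∀ (σ : Equiv.Perm (Fin k)) (v : Fin k → E), T (v ∘ σ) = T v

section Symmetry

variable {E F : Type*} [NormedAddCommGroup E] [NormedSpace ℝ E] [NormedAddCommGroup F]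
  [NormedSpace ℝ F] {k : ℕ} {f : E → F} {x : E}

lemma isSymm_of_comp_adjacent_swap {T : E [×(k + 1)]→L[ℝ] F}
    (hT : ∀ (i : Fin k) (v : Fin (k + 1) → E), T (v ∘ Equiv.swap i.castSucc i.succ) = T v) :
    IsSymm T := by
  intro σ
  have hσ : σ ∈ Submonoid.closure
      (Set.range fun i : Fin k => Equiv.swap i.castSucc i.succ) := by
    rw [Equiv.Perm.mclosure_swap_castSucc_succ]
    exact Submonoid.mem_top σ
  induction hσ using Submonoid.closure_induction with
  | mem _ hswap =>
    obtain ⟨i, rfl⟩ := hswap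
    exact hT i
  | one => exact fun _ => rfl
  | mul σ τ _ _ hσ hτ =>
    intro v
    rw [Equiv.Perm.coe_mul, ← Function.comp_assoc, hτ, hσ]

lemma iteratedFDeriv_add_two_apply (v : Fin (k + 2) → E) :
    iteratedFDeriv ℝ (k + 2) f x v =
      fderiv ℝ (fderiv ℝ (iteratedFDeriv ℝ k f)) x (v 0) (v 1) (Fin.tail (Fin.tail v)) := by
  let I : (E →L[ℝ] E [×k]→L[ℝ] F) ≃ₗᵢ[ℝ] E [×(k + 1)]→L[ℝ] F :=
    (continuousMultilinearCurryLeftEquiv ℝ (fun _ : Fin (k + 1) => E) F).symm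
  have hcurry : fderiv ℝ (iteratedFDeriv ℝ (k + 1) f) x =
      (I : (E →L[ℝ] E [×k]→L[ℝ] F) →L[ℝ] E [×(k + 1)]→L[ℝ] F) ∘L
        fderiv ℝ (fderiv ℝ (iteratedFDeriv ℝ k f)) x := by
    rw [iteratedFDeriv_succ_eq_comp_left]
    exact LinearIsometryEquiv.comp_fderiv (𝕜 := ℝ) (E := E →L[ℝ] E [×k]→L[ℝ] F)
      (F := E [×(k + 1)]→L[ℝ] F) (G := E) I
  rw [iteratedFDeriv_succ_apply_left, hcurry]
  rfl

lemma iteratedFDeriv_comp_swap_zero_one (hf : ContDiffAt ℝ (k + 2 : ℕ) f x)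
    (v : Fin (k + 2) → E) :
    iteratedFDeriv ℝ (k + 2) f x (v ∘ Equiv.swap 0 1) = iteratedFDeriv ℝ (k + 2) f x v := by
  have hsnd : IsSymmSndFDerivAt ℝ (iteratedFDeriv ℝ k f) x :=
    (hf.iteratedFDeriv_right (m := 2) (by rw [add_comm]; norm_cast)).isSymmSndFDerivAt (by simp)
  have htail : Fin.tail (Fin.tail (v ∘ Equiv.swap 0 1)) = Fin.tail (Fin.tail v) := by
    funext j
    simp only [Fin.tail, Function.comp_apply]
    rw [Equiv.swap_apply_of_ne_of_ne (Fin.succ_ne_zero _)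
      (by rw [← Fin.succ_zero_eq_one]; exact (Fin.succ_injective _).ne (Fin.succ_ne_zero _))]
  rw [iteratedFDeriv_add_two_apply, iteratedFDeriv_add_two_apply, htail, hsnd.eq]
  simp

lemma iteratedFDeriv_comp_swap_succ (hf : ContDiffAt ℝ (k + 1 : ℕ) f x) {i j : Fin k}
    (hsymm : ∀ᶠ y in nhds x, IsSymm (iteratedFDeriv ℝ k f y)) (v : Fin (k + 1) → E) :
    iteratedFDeriv ℝ (k + 1) f x (v ∘ Equiv.swap i.succ j.succ) =
      iteratedFDeriv ℝ (k + 1) f x v := by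
  have hd : DifferentiableAt ℝ (iteratedFDeriv ℝ k f) x :=
    hf.differentiableAt_iteratedFDeriv (by exact_mod_cast k.lt_succ_self)
  have hhead : (v ∘ Equiv.swap i.succ j.succ) 0 = v 0 := by
    rw [Function.comp_apply, Equiv.swap_apply_of_ne_of_ne] <;> exact (Fin.succ_ne_zero _).symm
  have htail : Fin.tail (v ∘ Equiv.swap i.succ j.succ) = Fin.tail v ∘ Equiv.swap i j := by
    funext p
    simp only [Fin.tail, Function.comp_apply, ← (Fin.succ_injective _).swap_apply]
  rw [hd.iteratedFDeriv_succ_apply_left', hd.iteratedFDeriv_succ_apply_left', hhead, htail]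
  congr 1
  exact Filter.EventuallyEq.fderiv_eq (hsymm.mono fun y hy => hy _ _)

theorem isSymm_iteratedFDeriv (hf : ContDiffAt ℝ k f x) : IsSymm (iteratedFDeriv ℝ k f x) := by
  induction k generalizing x with
  | zero => exact fun σ v => congrArg _ (Subsingleton.elim _ _)
  | succ k ih =>
    refine isSymm_of_comp_adjacent_swap fun i v => ?_
    cases k with
    | zero => exact i.elim0
    | succ k =>
      cases i using Fin.cases with
      | zero => exact iteratedFDeriv_comp_swap_zero_one hf v
      | succ i =>
        rw [← Fin.succ_castSucc]
        have hf' : ContDiffAt ℝ (k + 1 : ℕ) f x := hf.of_le (by norm_cast; omega)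
        exact iteratedFDeriv_comp_swap_succ hf
          ((hf'.eventually (by simp)).mono fun _ hy => ih hy) v

end Symmetry

section PartialEvaluation

variable {E F : Type*} [NormedAddCommGroup E] [NormedSpace ℝ E] [NormedAddCommGroup F]
  [NormedSpace ℝ F] {l m : ℕ}

/-- The form `T[h, …, h, ·]` obtained from `T` by fixing its first `m` arguments to be `h`, as a
continuous linear function of `T`. -/
noncomputable def fixFirst (h : E) : (E [×(m + l)]→L[ℝ] F) →L[ℝ] E [×l]→L[ℝ] F :=
  (ContinuousMultilinearMap.apply ℝ (fun _ : Fin m => E) (E [×l]→L[ℝ] F) fun _ => h) ∘L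
    ((ContinuousMultilinearMap.domDomCongrₗᵢ ℝ E F finSumFinEquiv.symm).trans
      (ContinuousMultilinearMap.currySumEquiv ℝ (Fin m) (Fin l) E F) :
        (E [×(m + l)]→L[ℝ] F) →L[ℝ] E [×m]→L[ℝ] E [×l]→L[ℝ] F)

lemma fixFirst_apply (h : E) (T : E [×(m + l)]→L[ℝ] F) (v : Fin l → E) :
    fixFirst h T v = T (Fin.append (fun _ => h) v) := by
  change T (fun i => Sum.elim (fun _ => h) v (finSumFinEquiv.symm i)) = _
  congr 1
  funext i
  refine Fin.addCases (fun p => ?_) (fun p => ?_) i <;> simp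

lemma norm_fixFirst_apply_le (h : E) (T : E [×(m + l)]→L[ℝ] F) :
    ‖fixFirst h T‖ ≤ ‖T‖ * ‖h‖ ^ m := by
  let curried : E [×m]→L[ℝ] E [×l]→L[ℝ] F :=
    ContinuousMultilinearMap.currySumEquiv ℝ (Fin m) (Fin l) E F
      (T.domDomCongr finSumFinEquiv.symm)
  have hnorm : ‖curried‖ = ‖T‖ :=
    (LinearIsometryEquiv.norm_map _ _).trans (ContinuousMultilinearMap.norm_domDomCongr ..)
  calc ‖fixFirst h T‖ ≤ ‖curried‖ * ∏ _i : Fin m, ‖h‖ := curried.le_opNorm fun _ => h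
    _ = ‖T‖ * ‖h‖ ^ m := by simp [hnorm]

lemma isSymm_fixFirst {T : E [×(m + l)]→L[ℝ] F} (hT : IsSymm T) (h : E) :
    IsSymm (fixFirst h T) := by
  intro σ v
  rw [fixFirst_apply, fixFirst_apply,
    ← hT (finSumFinEquiv.permCongr (Equiv.sumCongr (Equiv.refl (Fin m)) σ))
      (Fin.append (fun _ => h) v)]
  congr 1
  funext j
  refine Fin.addCases (fun p => ?_) (fun p => ?_) j <;> simp [Equiv.permCongr_apply]

end PartialEvaluation

section UStatistics

variable {n k : ℕ}

/-- The increasing enumeration of the range of `j`. -/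
def sortEmb (j : Fin k ↪ Fin n) : Fin k ↪o Fin n :=
  OrderEmbedding.ofStrictMono (j ∘ Tuple.sort j)
    ((Tuple.monotone_sort j).strictMono_of_injective (j.injective.comp (Tuple.sort j).injective))

lemma coe_sortEmb (j : Fin k ↪ Fin n) : ⇑(sortEmb j) = j ∘ Tuple.sort j := rfl

lemma range_sortEmb (j : Fin k ↪ Fin n) : Set.range (sortEmb j) = Set.range j := by
  rw [coe_sortEmb, EquivLike.range_comp]

lemma card_orderEmb (k n : ℕ) : Fintype.card (Fin k ↪o Fin n) = n.choose k := by
  rw [← Nat.card_eq_fintype_card, Nat.card_congr Set.powersetCard.ofFinEmbEquiv,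
    Set.powersetCard.card, Nat.card_fin]

lemma sum_orderEmb_comp_perm {φ : (Fin k → Fin n) → ℝ}
    (hφ : ∀ (π : Equiv.Perm (Fin k)) v, φ (v ∘ π) = φ v) (σ : Equiv.Perm (Fin n)) :
    ∑ j : Fin k ↪o Fin n, φ (σ ∘ j) = ∑ j : Fin k ↪o Fin n, φ j := by
  let sorted (j : Fin k ↪o Fin n) := sortEmb (j.toEmbedding.trans σ.toEmbedding)
  have hsorted : Function.Injective sorted := by
    intro j j' h
    have hrange : σ '' Set.range j = σ '' Set.range j' := by
      rw [← Set.range_comp, ← Set.range_comp]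
      exact (range_sortEmb _).symm.trans
        ((congrArg (fun e : Fin k ↪o Fin n => Set.range e) h).trans (range_sortEmb _))
    exact DFunLike.coe_injective
      ((j.strictMono.range_inj j'.strictMono).1 (σ.injective.image_injective hrange))
  refine Fintype.sum_bijective sorted (Finite.injective_iff_bijective.1 hsorted) _ _ fun j => ?_
  rw [coe_sortEmb, hφ]
  rfl

lemma sum_perm_comp_emb (φ : (Fin k → Fin n) → ℝ) (e e' : Fin k ↪ Fin n) :
    ∑ σ : Equiv.Perm (Fin n), φ (σ ∘ e) = ∑ σ : Equiv.Perm (Fin n), φ (σ ∘ e') := by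
  obtain ⟨τ, hτ⟩ := Equiv.Perm.exists_extending_pair e' e e'.injective e.injective
  refine Fintype.sum_bijective (· * τ) (Group.mulRight_bijective τ) _ _ fun σ => ?_
  congr 1
  funext i
  simp [hτ]

variable {B : Type*} [NormedAddCommGroup B] [NormedSpace ℝ B]

lemma uStat_eq_average_perm {T : B [×k]→L[ℝ] ℝ} (hT : IsSymm T) (w : Fin n → B) (b : B)
    (e : Fin k ↪ Fin n) :
    uStat T w b = (n.factorial : ℝ)⁻¹ *
      ∑ σ : Equiv.Perm (Fin n), T (fun i => w (σ (e i)) - b) := by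
  let φ (a : Fin k → Fin n) : ℝ := T fun i => w (a i) - b
  have hφ (π : Equiv.Perm (Fin k)) (a : Fin k → Fin n) : φ (a ∘ π) = φ a :=
    hT π fun i => w (a i) - b
  have hk : k ≤ n := by simpa using Fintype.card_le_of_embedding e
  have hchoose : (n.choose k : ℝ) ≠ 0 := by exact_mod_cast (Nat.choose_pos hk).ne'
  have hfact : (n.factorial : ℝ) ≠ 0 := by exact_mod_cast n.factorial_ne_zero
  have hdouble : (n.choose k : ℝ) * ∑ σ : Equiv.Perm (Fin n), φ (σ ∘ e) =
      n.factorial * ∑ j : Fin k ↪o Fin n, φ j :=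
    calc (n.choose k : ℝ) * ∑ σ : Equiv.Perm (Fin n), φ (σ ∘ e)
        = ∑ j : Fin k ↪o Fin n, ∑ σ : Equiv.Perm (Fin n), φ (σ ∘ j) := by
          have hsum (j : Fin k ↪o Fin n) := sum_perm_comp_emb φ j.toEmbedding e
          simp only [RelEmbedding.coe_toEmbedding] at hsum
          simp [hsum, card_orderEmb]
      _ = ∑ σ : Equiv.Perm (Fin n), ∑ j : Fin k ↪o Fin n, φ (σ ∘ j) := Finset.sum_comm
      _ = n.factorial * ∑ j : Fin k ↪o Fin n, φ j := by
          simp [sum_orderEmb_comp_perm hφ, Fintype.card_perm]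
  change (n.choose k : ℝ)⁻¹ * ∑ j : Fin k ↪o Fin n, φ j =
    (n.factorial : ℝ)⁻¹ * ∑ σ : Equiv.Perm (Fin n), φ (σ ∘ e)
  field_simp
  linear_combination -hdouble

lemma exists_perm_natAdd_mem_iff {l m : ℕ} {S : Finset (Fin (m + l))} (hS : S.card = l) :
    ∃ π : Equiv.Perm (Fin (m + l)),
      (∀ i, π (Fin.castAdd l i) ∉ S) ∧ ∀ i, π (Fin.natAdd m i) ∈ S := by
  obtain ⟨π, rfl⟩ := Equiv.Perm.exists_map_finset_eq
    (Finset.univ.map (Fin.natAddEmb m : Fin l ↪ Fin (m + l))) S (by simp [hS])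
  refine ⟨π, fun i hi => ?_, fun i => by simp⟩
  simp [Fin.ext_iff] at hi
  omega

lemma IsSymm.sum_perm_piecewise {l m : ℕ} {T : B [×(m + l)]→L[ℝ] ℝ} (hT : IsSymm T)
    (x : Fin n → B) (h : B) (e : Fin (m + l) ↪ Fin n) (e' : Fin l ↪ Fin n)
    {S : Finset (Fin (m + l))} (hS : S.card = l) :
    ∑ σ : Equiv.Perm (Fin n), T (S.piecewise (fun i => x (σ (e i))) fun _ => h) =
      ∑ σ : Equiv.Perm (Fin n), fixFirst h T fun i => x (σ (e' i)) := by
  obtain ⟨π, hnotMem, hmem⟩ := exists_perm_natAdd_mem_iff hS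
  calc ∑ σ : Equiv.Perm (Fin n), T (S.piecewise (fun i => x (σ (e i))) fun _ => h)
      = ∑ σ : Equiv.Perm (Fin n),
          fixFirst h T fun i => x (σ (e (π (Fin.natAdd m i)))) := by
        refine Finset.sum_congr rfl fun σ _ => ?_
        rw [← hT π, fixFirst_apply]
        congr 1
        funext j
        refine Fin.addCases (fun p => ?_) (fun p => ?_) j
        · simp [hnotMem p]
        · simp [hmem p]
    _ = ∑ σ : Equiv.Perm (Fin n), fixFirst h T fun i => x (σ (e' i)) :=
        sum_perm_comp_emb (fun a => fixFirst h T fun i => x (a i))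
          (((Fin.natAddEmb m).trans π.toEmbedding).trans e) e'

-- As a family, `T` can be evaluated at `p.1 + p.2` without transporting along `p.1 + p.2 = k`.
theorem uStat_recenter {T : ∀ k : ℕ, B [×k]→L[ℝ] ℝ} (hT : IsSymm (T k)) (hk : k ≤ n)
    (w : Fin n → B) (t θ : B) :
    uStat (T k) w t = ∑ p ∈ Finset.HasAntidiagonal.antidiagonal k,
      (k.choose p.2 : ℝ) * uStat (fixFirst (l := p.2) (θ - t) (T (p.1 + p.2))) w θ := by
  classical
  have hexpand (σ : Equiv.Perm (Fin n)) : T k (fun i => w (σ (Fin.castLEEmb hk i)) - t) =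
      ∑ S : Finset (Fin k), T k (S.piecewise (fun i => w (σ (Fin.castLEEmb hk i)) - θ)
        fun _ => θ - t) := by
    rw [← ContinuousMultilinearMap.map_add_univ]
    congr 1
    funext i
    simp
  rw [uStat_eq_average_perm hT w t (Fin.castLEEmb hk),
    Finset.sum_congr rfl fun σ _ => hexpand σ, Finset.sum_comm, Finset.mul_sum,
    ← Finset.powerset_univ, Finset.sum_powerset, Finset.card_univ, Fintype.card_fin,
    ← Finset.Nat.sum_antidiagonal_eq_sum_range_succ_mk (fun p : ℕ × ℕ =>
      ∑ S ∈ Finset.powersetCard p.1 Finset.univ, (n.factorial : ℝ)⁻¹ * ∑ σ : Equiv.Perm (Fin n),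
        T k (S.piecewise (fun i => w (σ (Fin.castLEEmb hk i)) - θ) fun _ => θ - t)),
    ← Finset.Nat.sum_antidiagonal_swap]
  refine Finset.sum_congr rfl fun p hp => ?_
  obtain ⟨m, l⟩ := p
  obtain rfl : m + l = k := Finset.HasAntidiagonal.mem_antidiagonal.1 hp
  have hl : l ≤ n := by omega
  rw [uStat_eq_average_perm (isSymm_fixFirst hT _) w θ (Fin.castLEEmb hl), Prod.fst_swap,
    Finset.sum_congr rfl fun S hS => by
      rw [hT.sum_perm_piecewise (fun i => w i - θ) (θ - t) (Fin.castLEEmb hk)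
        (Fin.castLEEmb hl) (Finset.mem_powersetCard.1 hS).2]]
  simp

lemma uStat_sum {ι : Type*} (s : Finset ι) (T : ι → B [×k]→L[ℝ] ℝ) (w : Fin n → B) (b : B) :
    uStat (∑ i ∈ s, T i) w b = ∑ i ∈ s, uStat (T i) w b := by
  simp only [uStat, sum_apply, ← Finset.mul_sum]
  rw [Finset.sum_comm]

lemma uStat_smul (c : ℝ) (T : B [×k]→L[ℝ] ℝ) (w : Fin n → B) (b : B) :
    uStat (c • T) w b = c * uStat T w b := by
  simp only [uStat, smul_apply, smul_eq_mul, ← Finset.mul_sum]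
  ring

lemma uStat_sub (T T' : B [×k]→L[ℝ] ℝ) (w : Fin n → B) (b : B) :
    uStat (T - T') w b = uStat T w b - uStat T' w b := by
  simp only [uStat, sub_apply, Finset.sum_sub_distrib, mul_sub]

lemma uStat_fin_zero (T : B [×0]→L[ℝ] ℝ) (w : Fin n → B) (b : B) : uStat T w b = T 0 := by
  have hconst (j : Fin 0 ↪o Fin n) : T (fun i => w (j i) - b) = T 0 :=
    congrArg T (Subsingleton.elim _ _)
  simp only [uStat, hconst, Finset.sum_const, Finset.card_univ, card_orderEmb]
  simp

lemma uStat_fin_one (hn : n ≠ 0) (T : B [×1]→L[ℝ] ℝ) (w : Fin n → B) (b : B) :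
    uStat T w b = T fun _ => sampleMean w - b := by
  obtain ⟨L, rfl⟩ := (ContinuousMultilinearMap.ofSubsingleton ℝ B ℝ (0 : Fin 1)).surjective T
  have hbij : Function.Bijective fun j : Fin 1 ↪o Fin n => j 0 := by
    refine ⟨fun j j' h => ?_, fun i => ⟨OrderEmbedding.ofStrictMono (fun _ => i)
      (Subsingleton.strictMono _), rfl⟩⟩
    ext i
    rw [Subsingleton.elim i 0]
    exact congrArg _ h
  have hsum : ∑ j : Fin 1 ↪o Fin n, L (w (j 0) - b) = ∑ i, L (w i - b) :=
    Fintype.sum_bijective _ hbij _ _ fun j => rfl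
  simp only [uStat, ContinuousMultilinearMap.ofSubsingleton_apply_apply, hsum]
  simp only [map_sub, sampleMean, map_smul, map_sum, Finset.sum_sub_distrib, Finset.sum_const,
    Finset.card_univ, Fintype.card_fin, Nat.choose_one_right, smul_eq_mul, nsmul_eq_mul]
  field_simp

end UStatistics

section Taylor

variable {E F : Type*} [NormedAddCommGroup E] [NormedSpace ℝ E] [NormedAddCommGroup F]
  [NormedSpace ℝ F]

lemma norm_sub_sum_pow_smul_le {g : ℕ → ℝ → F} {N : ℕ} {K : ℝ}
    (hg : ∀ m < N, ∀ u ∈ Set.Icc (0 : ℝ) 1, HasDerivAt (g m) (g (m + 1) u) u)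
    (hK : ∀ u ∈ Set.Icc (0 : ℝ) 1, ‖g N u‖ ≤ K) :
    ∀ u ∈ Set.Icc (0 : ℝ) 1,
      ‖g 0 u - ∑ m ∈ Finset.range N, (u ^ m / m.factorial) • g m 0‖ ≤
        K * (u ^ N / N.factorial) := by
  induction N generalizing g with
  | zero => simpa using hK
  | succ N ih =>
    have hmonomial (m : ℕ) (u : ℝ) : HasDerivAt
        (fun u : ℝ => u ^ (m + 1) / ((m + 1).factorial : ℝ)) (u ^ m / m.factorial) u := by
      refine ((hasDerivAt_pow (m + 1) u).div_const _).congr_deriv ?_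
      rw [Nat.factorial_succ]
      push_cast
      field_simp
    have hderiv : ∀ u ∈ Set.Icc (0 : ℝ) 1, HasDerivAt
        (fun u => g 0 u - ∑ m ∈ Finset.range (N + 1), (u ^ m / m.factorial) • g m 0)
        (g 1 u - ∑ m ∈ Finset.range N, (u ^ m / m.factorial) • g (m + 1) 0) u := by
      intro u hu
      simp only [Finset.sum_range_succ', pow_zero]
      exact (hg 0 N.succ_pos u hu).sub
        ((HasDerivAt.fun_sum fun m _ => (hmonomial m u).smul_const (g (m + 1) 0)).add_const _)
    have hbound := ih (g := fun m => g (m + 1)) (fun m hm => hg (m + 1) (by omega)) hK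
    exact image_norm_le_of_norm_deriv_right_le_deriv_boundary
      (fun u hu => (hderiv u hu).continuousAt.continuousWithinAt)
      (fun u hu => (hderiv u (Set.Ico_subset_Icc_self hu)).hasDerivWithinAt)
      (by simp [Finset.sum_range_succ']) (fun u => (hmonomial N u).const_mul K)
      (fun u hu => hbound u (Set.Ico_subset_Icc_self hu))

/-- The Taylor expansion of `D^l f` from `t` to `θ`, as far as it involves derivatives of `f` of
order at most `s`. -/
noncomputable def taylorForm (f : E → F) (s : ℕ) (t θ : E) (l : ℕ) : E [×l]→L[ℝ] F :=
  ∑ m ∈ Finset.range (s + 1 - l),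
    (m.factorial : ℝ)⁻¹ • fixFirst (θ - t) (iteratedFDeriv ℝ (m + l) f t)

variable {f : E → F} {s l m : ℕ} {t θ h : E} {u : ℝ}

lemma iteratedFDeriv_comp_cast {a b : ℕ} (hab : a = b) (v : Fin b → E) :
    iteratedFDeriv ℝ a f t (v ∘ Fin.cast hab) = iteratedFDeriv ℝ b f t v := by
  subst hab
  rfl

lemma hasDerivAt_fixFirst_iteratedFDeriv (hf : ContDiffAt ℝ (m + l + 1 : ℕ) f (t + u • h)) :
    HasDerivAt (fun u : ℝ => fixFirst h (iteratedFDeriv ℝ (m + l) f (t + u • h)))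
      (fixFirst h (iteratedFDeriv ℝ (m + 1 + l) f (t + u • h))) u := by
  have hd : DifferentiableAt ℝ (iteratedFDeriv ℝ (m + l) f) (t + u • h) :=
    hf.differentiableAt_iteratedFDeriv (by exact_mod_cast (m + l).lt_succ_self)
  have hline : HasDerivAt (fun u : ℝ => t + u • h) h u := by
    simpa using ((hasDerivAt_id u).smul_const h).const_add t
  refine ((fixFirst h).hasFDerivAt.comp_hasDerivAt u
    (hd.hasFDerivAt.comp_hasDerivAt u hline)).congr_deriv ?_
  ext v
  have hcons : (fun _ : Fin (m + 1) => h) = Fin.cons h fun _ : Fin m => h :=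
    (Fin.cons_self_tail _).symm
  rw [fixFirst_apply, fixFirst_apply, hcons, Fin.append_cons, iteratedFDeriv_comp_cast,
    iteratedFDeriv_succ_apply_left]
  rfl

theorem norm_iteratedFDeriv_sub_taylorForm_le (hl : l ≤ s) {K : ℝ}
    (hf : ∀ x ∈ segment ℝ t θ, ContDiffAt ℝ (s + 1 : ℕ) f x)
    (hK : ∀ x ∈ segment ℝ t θ, ‖iteratedFDeriv ℝ (s + 1) f x‖ ≤ K) :
    ‖iteratedFDeriv ℝ l f θ - taylorForm f s t θ l‖ ≤
      K * ‖θ - t‖ ^ (s + 1 - l) / (s + 1 - l).factorial := by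
  obtain ⟨N, hN⟩ := Nat.exists_eq_add_of_le' (hl.trans s.le_succ)
  have hsegment : ∀ u ∈ Set.Icc (0 : ℝ) 1, t + u • (θ - t) ∈ segment ℝ t θ := by
    intro u hu
    rw [segment_eq_image']
    exact ⟨u, hu, rfl⟩
  rw [Nat.succ_eq_add_one] at hN
  rw [hN] at hf hK
  have key := norm_sub_sum_pow_smul_le (N := N) (K := K * ‖θ - t‖ ^ N)
    (g := fun m u => fixFirst (l := l) (θ - t) (iteratedFDeriv ℝ (m + l) f (t + u • (θ - t))))
    (fun m hm u hu => hasDerivAt_fixFirst_iteratedFDeriv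
      ((hf _ (hsegment u hu)).of_le (by norm_cast; omega)))
    (fun u hu => (norm_fixFirst_apply_le _ _).trans
      (mul_le_mul_of_nonneg_right (hK _ (hsegment u hu)) (by positivity)))
    1 (Set.right_mem_Icc.2 zero_le_one)
  have hzero : fixFirst (m := 0) (θ - t) (iteratedFDeriv ℝ (0 + l) f θ) =
      iteratedFDeriv ℝ l f θ := by
    ext v
    rw [fixFirst_apply, Fin.append_left_nil _ _ rfl, iteratedFDeriv_comp_cast]
  simpa [taylorForm, show s + 1 - l = N by omega, hzero, div_eq_mul_inv, mul_assoc] using key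

end Taylor

section OneSided

variable {B : Type*} [NormedAddCommGroup B] [NormedSpace ℝ B] {n s : ℕ} {f : B → ℝ} {t : B}

lemma oneSided_eq_sum_range (w : Fin n → B) : oneSided f s w t =
    ∑ k ∈ Finset.range (s + 1), uStat (iteratedFDeriv ℝ k f t) w t / k.factorial := by
  rw [Finset.sum_range_eq_add_Ico _ s.succ_pos, oneSided, uStat_fin_zero,
    iteratedFDeriv_zero_apply, Nat.factorial_zero, Nat.cast_one, div_one]
  rfl

theorem oneSided_eq_sum_uStat_taylorForm (hs : s ≤ n) (hf : ContDiffAt ℝ s f t) (w : Fin n → B)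
    (θ : B) : oneSided f s w t =
      ∑ l ∈ Finset.range (s + 1), uStat (taylorForm f s t θ l) w θ / l.factorial := by
  let g (l m : ℕ) : ℝ := (m.factorial : ℝ)⁻¹ *
    uStat (fixFirst (l := l) (θ - t) (iteratedFDeriv ℝ (m + l) f t)) w θ / l.factorial
  have hrecenter : ∀ k ∈ Finset.range (s + 1),
      uStat (iteratedFDeriv ℝ k f t) w t / k.factorial =
        ∑ i ∈ Finset.range (k + 1), g i (k - i) := by
    intro k hk
    have hk : k ≤ s := Nat.lt_succ_iff.1 (Finset.mem_range.1 hk)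
    rw [uStat_recenter (T := fun k => iteratedFDeriv ℝ k f t)
        (isSymm_iteratedFDeriv (hf.of_le (by exact_mod_cast hk))) (hk.trans hs) w t θ,
      ← Finset.Nat.sum_antidiagonal_eq_sum_range_succ g,
      ← Finset.Nat.sum_antidiagonal_swap (f := fun p => g p.1 p.2), Finset.sum_div]
    refine Finset.sum_congr rfl fun p hp => ?_
    obtain ⟨m, l⟩ := p
    obtain rfl : m + l = k := Finset.HasAntidiagonal.mem_antidiagonal.1 hp
    simp only [g, Prod.fst_swap, Prod.snd_swap, ← Nat.choose_symm_add (a := m),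
      Nat.cast_add_choose]
    field_simp
  rw [oneSided_eq_sum_range, Finset.sum_congr rfl hrecenter, Finset.sum_range_diag_flip (s + 1) g]
  refine Finset.sum_congr rfl fun l _ => ?_
  simp only [taylorForm, uStat_sum, uStat_smul, Finset.sum_div, g]

end OneSided

section LTwo

variable {X : Type*} [MeasurableSpace X] {μ : Measure X}

lemma eLpNorm_two_eq_ofReal_sqrt {h : X → ℝ} (hh : MemLp h 2 μ) :
    eLpNorm h 2 μ = ENNReal.ofReal (√(∫ x, h x ^ 2 ∂μ)) := by
  rw [hh.eLpNorm_eq_integral_rpow_norm (by simp) (by simp)]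
  simp [Real.sqrt_eq_rpow]

lemma integrable_sq_and_sqrt_integral_le {h : X → ℝ} {K : ℝ} (hh : AEStronglyMeasurable h μ)
    (hK : 0 ≤ K) (hb : eLpNorm h 2 μ ≤ ENNReal.ofReal K) :
    Integrable (fun x => h x ^ 2) μ ∧ √(∫ x, h x ^ 2 ∂μ) ≤ K := by
  have hm : MemLp h 2 μ := ⟨hh, hb.trans_lt ENNReal.ofReal_lt_top⟩
  refine ⟨hm.integrable_sq, ?_⟩
  rw [eLpNorm_two_eq_ofReal_sqrt hm] at hb
  exact (ENNReal.ofReal_le_ofReal_iff hK).1 hb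

end LTwo

section ProductMeasure

variable {ι κ : Type*} [Fintype ι] [Fintype κ]

lemma measurePreserving_update [DecidableEq ι] {X : ι → Type*} [∀ i, MeasurableSpace (X i)]
    (μ : ∀ i, Measure (X i)) [∀ i, IsProbabilityMeasure (μ i)] (i : ι) :
    MeasurePreserving (fun p : (∀ i, X i) × X i => Function.update p.1 i p.2)
      ((Measure.pi μ).prod (μ i)) (Measure.pi μ) := by
  refine ⟨measurable_update', (Measure.pi_eq fun s hs => ?_).symm⟩
  have hpre : (fun p : (∀ i, X i) × X i => Function.update p.1 i p.2) ⁻¹' Set.univ.pi s =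
      Set.univ.pi (Function.update s i Set.univ) ×ˢ s i := by
    ext p
    simp only [Set.mem_preimage, Set.mem_univ_pi, Set.mem_prod]
    rw [Function.forall_update_iff (p := fun j z => z ∈ s j),
      Function.forall_update_iff (p := fun j t => p.1 j ∈ t)]
    simp [and_comm]
  rw [Measure.map_apply measurable_update' (.univ_pi hs), hpre, Measure.prod_prod, Measure.pi_pi,
    ← Finset.mul_prod_erase Finset.univ (fun j => μ j (s j)) (Finset.mem_univ i),
    ← Finset.mul_prod_erase Finset.univ _ (Finset.mem_univ i), mul_comm]
  congr 1
  rw [Function.update_self, measure_univ, one_mul]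
  exact Finset.prod_congr rfl fun j hj => by rw [Function.update_of_ne (Finset.ne_of_mem_erase hj)]

lemma integral_pi_eq_integral_integral_update [DecidableEq ι] {X : ι → Type*}
    [∀ i, MeasurableSpace (X i)] {μ : ∀ i, Measure (X i)} [∀ i, IsProbabilityMeasure (μ i)]
    {E : Type*} [NormedAddCommGroup E] [NormedSpace ℝ E] {h : (∀ i, X i) → E}
    (hh : Integrable h (Measure.pi μ)) (i : ι) :
    ∫ x, h x ∂Measure.pi μ = ∫ x, ∫ a, h (Function.update x i a) ∂μ i ∂Measure.pi μ := by
  have hmp := measurePreserving_update μ i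
  have hint : Integrable (fun p : (∀ i, X i) × X i => h (Function.update p.1 i p.2))
      ((Measure.pi μ).prod (μ i)) := hmp.integrable_comp_of_integrable hh
  rw [← integral_prod _ hint, ← integral_map hmp.measurable.aemeasurable
    (hmp.map_eq.symm ▸ hh.aestronglyMeasurable), hmp.map_eq]

variable {B : Type*} [MeasurableSpace B] {P : Measure B} [IsProbabilityMeasure P]

lemma measurePreserving_precomp {j : κ → ι} (hj : j.Injective) :
    MeasurePreserving (fun (x : ι → B) i => x (j i))
      (Measure.pi fun _ => P) (Measure.pi fun _ => P) := by
  have h := (iIndepFun_pi (μ := fun _ : ι => P) (X := fun _ b => b)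
    (fun _ => aemeasurable_id)).precomp hj
  rw [iIndepFun_iff_map_fun_eq_pi_map (fun i => (measurable_pi_apply _).aemeasurable)] at h
  refine ⟨by fun_prop, h.trans ?_⟩
  simp only [(measurePreserving_eval (fun _ : ι => P) _).map_eq]

lemma integrable_and_integral_prod_precomp {g : B → ℝ} (hg : Integrable g P) {j : κ → ι}
    (hj : j.Injective) :
    Integrable (fun x : ι → B => ∏ i, g (x (j i))) (Measure.pi fun _ => P) ∧
      ∫ x : ι → B, ∏ i, g (x (j i)) ∂(Measure.pi fun _ => P) =
        (∫ b, g b ∂P) ^ Fintype.card κ := by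
  have hmp := measurePreserving_precomp (P := P) hj
  have hint : Integrable (fun x : κ → B => ∏ i, g (x i)) (Measure.pi fun _ => P) :=
    .fintype_prod fun _ => hg
  refine ⟨hmp.integrable_comp_of_integrable hint, ?_⟩
  rw [← integral_fintype_prod_eq_pow, ← hmp.map_eq,
    integral_map hmp.measurable.aemeasurable (hmp.map_eq.symm ▸ hint.aestronglyMeasurable)]

lemma aestronglyMeasurable_id_pi [TopologicalSpace B] [AddCommMonoid B] [ContinuousAdd B]
    (hP : AEStronglyMeasurable id P) :
    AEStronglyMeasurable id (Measure.pi fun _ : ι => P) := by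
  classical
  have hsum : (id : (ι → B) → ι → B) = fun x => ∑ i, Pi.single i (x i) :=
    funext fun x => (Finset.univ_sum_single x).symm
  rw [hsum]
  exact Finset.aestronglyMeasurable_fun_sum _ fun i _ =>
    (continuous_single i).comp_aestronglyMeasurable <|
      hP.comp_quasiMeasurePreserving (Measure.quasiMeasurePreserving_eval _ i)

end ProductMeasure

section Kernel

variable {B : Type*} [NormedAddCommGroup B] [NormedSpace ℝ B] {ι κ : Type*} {k : ℕ}

lemma kernel_update [DecidableEq ι] [DecidableEq κ]
    (G : ContinuousMultilinearMap ℝ (fun _ : κ => B) ℝ) {j : κ → ι} (hj : j.Injective) (p : κ)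
    (x : ι → B) (a θ : B) : G (fun i => Function.update x (j p) a (j i) - θ) =
      G.toContinuousLinearMap (fun i => x (j i) - θ) p (a - θ) := by
  rw [ContinuousMultilinearMap.toContinuousLinearMap_apply]
  congr 1
  ext i
  obtain rfl | hi := eq_or_ne i p
  · simp
  · rw [Function.update_of_ne hi, Function.update_of_ne (hj.ne hi)]

lemma norm_toContinuousLinearMap_zero_le
    (G : ContinuousMultilinearMap ℝ (fun _ : Fin (k + 1) => B) ℝ) (m : Fin (k + 1) → B) :
    ‖G.toContinuousLinearMap m 0‖ ≤ ‖G‖ * ∏ i : Fin k, ‖m i.succ‖ := by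
  refine ContinuousLinearMap.opNorm_le_bound _ (by positivity) fun a => ?_
  rw [ContinuousMultilinearMap.toContinuousLinearMap_apply]
  refine (G.le_opNorm _).trans_eq ?_
  rw [Fin.prod_univ_succ]
  simp only [Function.update_self, ne_eq, Fin.succ_ne_zero, not_false_eq_true,
    Function.update_of_ne]
  ring

end Kernel

section Moments

variable {B : Type*} [NormedAddCommGroup B] [NormedSpace ℝ B] [MeasurableSpace B]
  {P : Measure B} {ι κ κ' : Type*} {n k : ℕ}

lemma weakVar_nonneg (P : Measure B) : 0 ≤ weakVar P :=
  Real.iSup_nonneg fun _ => integral_nonneg fun _ => sq_nonneg _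

lemma strongVar_nonneg (P : Measure B) : 0 ≤ strongVar P :=
  integral_nonneg fun _ => sq_nonneg _

variable [IsProbabilityMeasure P]

lemma integrable_norm_sub_mean_sq (hP : MemLp id 2 P) :
    Integrable (fun w : B => ‖w - mean P‖ ^ 2) P :=
  have h : MemLp (fun w => w - mean P) 2 P := hP.sub (memLp_const _)
  (memLp_two_iff_integrable_sq_norm h.1).1 h

lemma integral_dual_sq_le (hP : MemLp id 2 P) (u : StrongDual ℝ B) :
    ∫ w, u (w - mean P) ^ 2 ∂P ≤ weakVar P * ‖u‖ ^ 2 := by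
  have hbdd : BddAbove (Set.range fun u : {u : StrongDual ℝ B // ‖u‖ ≤ 1} =>
      ∫ w, |u.1 (w - mean P)| ^ 2 ∂P) := by
    refine ⟨strongVar P, Set.forall_mem_range.2 fun u => ?_⟩
    refine integral_mono_of_nonneg (.of_forall fun w => sq_nonneg _)
      (integrable_norm_sub_mean_sq hP) (.of_forall fun w => ?_)
    have := u.1.le_of_opNorm_le u.2 (w - mean P)
    rw [one_mul, Real.norm_eq_abs] at this
    dsimp only
    gcongr
  obtain rfl | hu := eq_or_ne u 0
  · simp
  have hunit := le_ciSup hbdd ⟨‖u‖⁻¹ • u, (norm_smul_inv_norm (𝕜 := ℝ) hu).le⟩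
  have hscale : ∫ w, |(‖u‖⁻¹ • u) (w - mean P)| ^ 2 ∂P =
      (‖u‖ ^ 2)⁻¹ * ∫ w, u (w - mean P) ^ 2 ∂P := by
    rw [← integral_const_mul]
    simp only [sq_abs, smul_apply, smul_eq_mul, mul_pow, inv_pow]
  rw [mul_comm, ← inv_mul_le_iff₀ (pow_pos (norm_pos_iff.2 hu) 2)]
  exact hscale.symm.trans_le hunit

lemma integral_dual_sub_mean_eq_zero [CompleteSpace B] (hP : Integrable id P)
    (u : StrongDual ℝ B) : ∫ w, u (w - mean P) ∂P = 0 := by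
  have hint : Integrable (fun w => w - mean P) P := hP.sub (integrable_const _)
  have hsub : ∫ w, (w - mean P) ∂P = mean P - mean P := by
    rw [integral_sub (f := fun w => w) hP (integrable_const _), integral_const, probReal_univ,
      one_smul, mean]
  rw [u.integral_comp_comm hint, hsub, sub_self, map_zero]

variable [Fintype ι] [Finite κ] [Finite κ']
  (G : ContinuousMultilinearMap ℝ (fun _ : κ => B) ℝ) {j : κ → ι}

lemma memLp_kernel (hP : MemLp id 2 P) (hj : j.Injective) :
    MemLp (fun x : ι → B => G fun i => x (j i) - mean P) 2 (Measure.pi fun _ => P) := by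
  cases nonempty_fintype κ
  have hcont : Continuous fun x : ι → B => G fun i => x (j i) - mean P := G.cont.comp (by fun_prop)
  have hm := hcont.comp_aestronglyMeasurable (aestronglyMeasurable_id_pi (ι := ι) hP.1)
  refine (memLp_two_iff_integrable_sq hm).2 <|
    ((integrable_and_integral_prod_precomp (integrable_norm_sub_mean_sq hP) hj).1.const_mul
      (‖G‖ ^ 2)).mono' (hm.pow 2) (.of_forall fun x => ?_)
  rw [Finset.prod_pow, ← mul_pow, norm_pow]
  exact pow_le_pow_left₀ (norm_nonneg _) (G.le_opNorm _) 2

lemma integral_kernel_mul_kernel_eq_zero [CompleteSpace B] (hP : MemLp id 2 P)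
    (G' : ContinuousMultilinearMap ℝ (fun _ : κ' => B) ℝ) (hj : j.Injective) {j' : κ' → ι}
    (hj' : j'.Injective) {p : κ} (hp : j p ∉ Set.range j') :
    ∫ x : ι → B, G (fun i => x (j i) - mean P) * G' (fun i => x (j' i) - mean P)
      ∂(Measure.pi fun _ => P) = 0 := by
  classical
  have hint : Integrable (fun x : ι → B => G (fun i => x (j i) - mean P) *
      G' fun i => x (j' i) - mean P) (Measure.pi fun _ => P) :=
    (memLp_kernel G hP hj).integrable_mul (memLp_kernel G' hP hj')
  rw [integral_pi_eq_integral_integral_update hint (j p)]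
  have hfix (x : ι → B) (a : B) (i : κ') : Function.update x (j p) a (j' i) = x (j' i) :=
    Function.update_of_ne (fun h => hp ⟨i, h⟩) _ _
  simp only [hfix, kernel_update G hj, integral_mul_const,
    integral_dual_sub_mean_eq_zero (hP.integrable one_le_two), zero_mul, integral_zero]

lemma integral_kernel_sq_le (hP : MemLp id 2 P)
    (G : ContinuousMultilinearMap ℝ (fun _ : Fin (k + 1) => B) ℝ) {j : Fin (k + 1) → ι}
    (hj : j.Injective) :
    ∫ x : ι → B, G (fun i => x (j i) - mean P) ^ 2 ∂(Measure.pi fun _ => P) ≤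
      ‖G‖ ^ 2 * (weakVar P * strongVar P ^ k) := by
  classical
  obtain ⟨hint, hprod⟩ := integrable_and_integral_prod_precomp (integrable_norm_sub_mean_sq hP)
    (hj.comp (Fin.succ_injective k))
  rw [integral_pi_eq_integral_integral_update (memLp_kernel G hP hj).integrable_sq (j 0)]
  calc ∫ x, ∫ a, G (fun i => Function.update x (j 0) a (j i) - mean P) ^ 2 ∂P
        ∂(Measure.pi fun _ => P)
      ≤ ∫ x : ι → B, weakVar P * ‖G‖ ^ 2 * ∏ i : Fin k, ‖x (j i.succ) - mean P‖ ^ 2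
          ∂(Measure.pi fun _ => P) := by
        refine integral_mono_of_nonneg (.of_forall fun x => integral_nonneg fun a => sq_nonneg _)
          (hint.const_mul _) (.of_forall fun x => ?_)
        simp only [kernel_update G hj]
        refine (integral_dual_sq_le hP _).trans ?_
        rw [mul_assoc, Finset.prod_pow, ← mul_pow]
        gcongr
        · exact weakVar_nonneg P
        · exact norm_toContinuousLinearMap_zero_le G _
    _ = ‖G‖ ^ 2 * (weakVar P * strongVar P ^ k) := by
        rw [integral_const_mul]
        simp only [Function.comp_apply, Fintype.card_fin] at hprod
        rw [hprod, strongVar]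
        ring

lemma memLp_uStat (hP : MemLp id 2 P) (G : ContinuousMultilinearMap ℝ (fun _ : Fin k => B) ℝ) :
    MemLp (fun x : Fin n → B => uStat G x (mean P)) 2 (Measure.pi fun _ => P) :=
  (memLp_finsetSum _ fun j _ => memLp_kernel G hP j.injective).const_mul _

lemma exists_notMem_range_of_ne {j j' : Fin k ↪o Fin n} (hjj' : j ≠ j') :
    ∃ p, j p ∉ Set.range j' := by
  by_contra! hsub
  refine hjj' (DFunLike.coe_injective ((j.strictMono.range_inj j'.strictMono).1 ?_))
  refine Set.eq_of_subset_of_ncard_le (Set.range_subset_iff.2 hsub) ?_ (Set.toFinite _)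
  simp only [← Set.image_univ, Set.ncard_image_of_injective _ j.injective,
    Set.ncard_image_of_injective _ j'.injective, le_refl]

variable [CompleteSpace B]

lemma integral_uStat_sq_le (hP : MemLp id 2 P)
    (G : ContinuousMultilinearMap ℝ (fun _ : Fin (k + 1) => B) ℝ) :
    ∫ x : Fin n → B, uStat G x (mean P) ^ 2 ∂(Measure.pi fun _ => P) ≤
      (n.choose (k + 1) : ℝ)⁻¹ * (‖G‖ ^ 2 * (weakVar P * strongVar P ^ k)) := by
  have hint (j j' : Fin (k + 1) ↪o Fin n) : Integrable (fun x : Fin n → B =>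
      G (fun i => x (j i) - mean P) * G (fun i => x (j' i) - mean P)) (Measure.pi fun _ => P) :=
    (memLp_kernel G hP j.injective).integrable_mul (memLp_kernel G hP j'.injective)
  have hdiag (j : Fin (k + 1) ↪o Fin n) : ∑ j' : Fin (k + 1) ↪o Fin n, ∫ x : Fin n → B,
      G (fun i => x (j i) - mean P) * G (fun i => x (j' i) - mean P) ∂(Measure.pi fun _ => P) ≤
      ‖G‖ ^ 2 * (weakVar P * strongVar P ^ k) := by
    rw [Finset.sum_eq_single_of_mem j (Finset.mem_univ j) fun j' _ hne =>
      have ⟨_, hp⟩ := exists_notMem_range_of_ne hne.symm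
      integral_kernel_mul_kernel_eq_zero G hP G j.injective j'.injective hp]
    simp only [← pow_two]
    exact integral_kernel_sq_le hP G j.injective
  calc ∫ x : Fin n → B, uStat G x (mean P) ^ 2 ∂(Measure.pi fun _ => P)
      = (n.choose (k + 1) : ℝ)⁻¹ ^ 2 * ∑ j : Fin (k + 1) ↪o Fin n, ∑ j' : Fin (k + 1) ↪o Fin n,
          ∫ x : Fin n → B, G (fun i => x (j i) - mean P) * G (fun i => x (j' i) - mean P)
            ∂(Measure.pi fun _ => P) := by
        simp only [uStat, mul_pow, pow_two (Finset.sum _ _), Finset.sum_mul_sum]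
        rw [integral_const_mul, integral_finsetSum _ fun j _ => integrable_finsetSum _ fun j' _ =>
          hint j j']
        simp only [integral_finsetSum _ fun j' _ => hint _ j']
    _ ≤ (n.choose (k + 1) : ℝ)⁻¹ ^ 2 * ∑ _j : Fin (k + 1) ↪o Fin n,
          ‖G‖ ^ 2 * (weakVar P * strongVar P ^ k) := by
        gcongr
        exact hdiag _
    _ = (n.choose (k + 1) : ℝ)⁻¹ * (‖G‖ ^ 2 * (weakVar P * strongVar P ^ k)) := by
        rw [Finset.sum_const, Finset.card_univ, card_orderEmb, nsmul_eq_mul, ← mul_assoc]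
        congr 1
        obtain h0 | h0 := eq_or_ne (n.choose (k + 1) : ℝ) 0
        · simp [h0]
        · field_simp

lemma eLpNorm_uStat_le (hP : MemLp id 2 P)
    (G : ContinuousMultilinearMap ℝ (fun _ : Fin (k + 1) => B) ℝ) :
    eLpNorm (fun x : Fin n → B => uStat G x (mean P)) 2 (Measure.pi fun _ => P) ≤
      ENNReal.ofReal (‖G‖ * (√(weakVar P) * √(strongVar P) ^ k / √(n.choose (k + 1)))) := by
  rw [eLpNorm_two_eq_ofReal_sqrt (memLp_uStat hP G)]
  refine ENNReal.ofReal_le_ofReal (Real.sqrt_le_iff.2 ⟨by positivity, ?_⟩)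
  refine (integral_uStat_sq_le hP G).trans_eq ?_
  rw [mul_pow, div_pow, mul_pow, ← pow_mul, mul_comm k, pow_mul, Real.sq_sqrt (weakVar_nonneg P),
    Real.sq_sqrt (strongVar_nonneg P), Real.sq_sqrt (Nat.cast_nonneg _)]
  ring

end Moments

section Numerics

lemma factorial_add_le_factorial_mul_pow (l m : ℕ) :
    (l + m).factorial ≤ l.factorial * (l + m) ^ m := by
  rw [← Nat.factorial_mul_ascFactorial]
  exact Nat.mul_le_mul_left _ (Nat.ascFactorial_le_pow_add l m)

lemma factorial_succ_le_two_mul_pow {s : ℕ} (hs : s ≠ 0) : (s + 1).factorial ≤ 2 * s ^ s := by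
  obtain ⟨k, rfl⟩ := Nat.exists_eq_succ_of_ne_zero hs
  have hfac : (k + 1).factorial ≤ (k + 1) ^ k := by
    simpa [add_comm] using factorial_add_le_factorial_mul_pow 1 k
  calc (k + 1 + 1).factorial = (k + 1 + 1) * (k + 1).factorial := rfl
    _ ≤ (2 * (k + 1)) * (k + 1) ^ k := Nat.mul_le_mul (by omega) hfac
    _ = 2 * (k + 1) ^ (k + 1) := by ring

lemma natCast_rpow_le_of_le_mul_pow {N c k m : ℕ} {L β : ℝ} (hβ : 0 ≤ β) (hN : N ≤ c * k ^ m)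
    (hk : (k : ℝ) ≤ L) : (N : ℝ) ^ β ≤ (c : ℝ) ^ β * (L ^ β) ^ m := by
  have hL : 0 ≤ L := k.cast_nonneg.trans hk
  rw [Real.rpow_pow_comm hL, ← Real.mul_rpow (by positivity) (by positivity)]
  refine Real.rpow_le_rpow (by positivity) ?_ hβ
  calc (N : ℝ) ≤ c * k ^ m := by exact_mod_cast hN
    _ ≤ c * L ^ m := by gcongr

lemma factorial_add_rpow_le {L β : ℝ} (hβ : 0 ≤ β) {l m : ℕ} (hL : ((l + m : ℕ) : ℝ) ≤ L) :
    ((l + m).factorial : ℝ) ^ β ≤ (l.factorial : ℝ) ^ β * (L ^ β) ^ m :=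
  natCast_rpow_le_of_le_mul_pow hβ (factorial_add_le_factorial_mul_pow l m) hL

lemma factorial_succ_rpow_le {L β : ℝ} (hβ : 0 ≤ β) {s : ℕ} (hs : s ≠ 0) (hL : (s : ℝ) ≤ L) :
    ((s + 1).factorial : ℝ) ^ β ≤ 2 ^ β * (L ^ β) ^ s := by
  exact_mod_cast natCast_rpow_le_of_le_mul_pow hβ (factorial_succ_le_two_mul_pow hs) hL

lemma factorial_rpow_eq_mul (k : ℕ) (α : ℝ) :
    (k.factorial : ℝ) ^ α = k.factorial * (k.factorial : ℝ) ^ (α - 1) := by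
  have hk : (k.factorial : ℝ) ≠ 0 := by exact_mod_cast k.factorial_ne_zero
  rw [Real.rpow_sub_one hk, mul_div_cancel₀ _ hk]

lemma div_pow_le_choose {n l : ℕ} (hl : l ≤ n) : ((n : ℝ) / l) ^ l ≤ n.choose l := by
  induction l generalizing n with
  | zero => simp
  | succ l ih =>
    obtain ⟨n, rfl⟩ : ∃ m, n = m + 1 := ⟨n - 1, by omega⟩
    have hln : l ≤ n := by omega
    have hchoose : ((n + 1).choose (l + 1) : ℝ) = ((n + 1 : ℕ) : ℝ) / (l + 1 : ℕ) * n.choose l := by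
      rw [div_mul_eq_mul_div, eq_div_iff (by positivity)]
      exact_mod_cast (Nat.add_one_mul_choose_eq n l).symm
    have hratio : ((n + 1 : ℕ) : ℝ) / (l + 1 : ℕ) ≤ n / l ∨ l = 0 := by
      rcases l.eq_zero_or_pos with hl0 | hl0
      · exact .inr hl0
      · have hl0' : (0 : ℝ) < l := by exact_mod_cast hl0
        have hln' : (l : ℝ) ≤ n := by exact_mod_cast hln
        rw [div_le_div_iff₀ (by positivity) hl0']
        exact .inl (by push_cast; linarith)
    rw [hchoose, pow_succ']
    gcongr
    obtain hratio | rfl := hratio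
    · exact (pow_le_pow_left₀ (by positivity) hratio l).trans (ih hln)
    · simp

lemma inv_sqrt_choose_le {n l : ℕ} (hl : l ≤ n) : (√(n.choose l))⁻¹ ≤ (√l / √n) ^ l := by
  obtain rfl | hl0 := eq_or_ne l 0
  · simp
  have hl' : (0 : ℝ) < l := by exact_mod_cast hl0.bot_lt
  have hn' : (0 : ℝ) < n := by exact_mod_cast hl0.bot_lt.trans_le hl
  rw [← inv_div, inv_pow]
  refine inv_anti₀ (by positivity) (Real.le_sqrt_of_sq_le ?_)
  rw [← pow_mul, mul_comm, pow_mul, div_pow, Real.sq_sqrt hl'.le, Real.sq_sqrt hn'.le]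
  exact div_pow_le_choose hl

lemma add_two_le_two_mul_sqrt_pow (k : ℕ) : ((k + 2 : ℕ) : ℝ) ≤ 2 * √(k + 2 : ℕ) ^ k := by
  have hsq : √((k + 2 : ℕ) : ℝ) ^ 2 = (k + 2 : ℕ) := Real.sq_sqrt (Nat.cast_nonneg _)
  have hone : 1 ≤ √((k + 2 : ℕ) : ℝ) := Real.one_le_sqrt.2 (by exact_mod_cast (by omega))
  match k with
  | 0 => norm_num
  | 1 =>
    have hle : √((1 + 2 : ℕ) : ℝ) ≤ 2 := Real.sqrt_le_iff.2 (by norm_num)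
    calc _ = √((1 + 2 : ℕ) : ℝ) ^ 2 := hsq.symm
      _ ≤ 2 * √((1 + 2 : ℕ) : ℝ) ^ 1 := by rw [pow_two, pow_one]; gcongr
  | i + 2 =>
    calc _ = √((i + 2 + 2 : ℕ) : ℝ) ^ 2 := hsq.symm
      _ ≤ √((i + 2 + 2 : ℕ) : ℝ) ^ (i + 2) := pow_le_pow_right₀ hone (by omega)
      _ ≤ 2 * √((i + 2 + 2 : ℕ) : ℝ) ^ (i + 2) := le_mul_of_one_le_left (by positivity) one_le_two

lemma sum_choose_mul_pow_le {x q : ℝ} (hx : 0 ≤ x) (hxq : x ≤ q) (hq : q < 1) (l N : ℕ) :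
    ∑ m ∈ Finset.range N, ((m + l).choose l : ℝ) * x ^ m ≤ 1 / (1 - q) ^ (l + 1) := by
  have hq0 : 0 ≤ q := hx.trans hxq
  calc ∑ m ∈ Finset.range N, ((m + l).choose l : ℝ) * x ^ m
      ≤ ∑ m ∈ Finset.range N, ((m + l).choose l : ℝ) * q ^ m := by gcongr
    _ ≤ 1 / (1 - q) ^ (l + 1) := sum_le_hasSum _ (fun m _ => by positivity)
      (hasSum_choose_mul_geometric_of_norm_lt_one l (by rwa [Real.norm_of_nonneg hq0]))

lemma sum_div_one_sub_pow_le {q : ℝ} (hq0 : 0 ≤ q) (hq : q < 1 / 2) (N : ℕ) :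
    ∑ k ∈ Finset.range N, (q / (1 - q)) ^ k ≤ (1 - q) / (1 - 2 * q) := by
  have hq1 : 0 < 1 - q := by linarith
  have hsum := hasSum_geometric_of_lt_one (div_nonneg hq0 hq1.le)
    ((div_lt_one hq1).2 (by linarith))
  refine (sum_le_hasSum (Finset.range N) (fun k _ => by positivity) hsum).trans_eq ?_
  rw [one_sub_div hq1.ne', inv_div]
  congr 1
  ring

lemma pow_mul_factorial_rpow_mul_sqrt_pow_div_sqrt_choose_le {α R V L q : ℝ} {n k : ℕ}
    (hk : ((k + 2 : ℕ) : ℝ) ≤ L) (hkn : k + 2 ≤ n) (hα : 1 ≤ α) (hR : 0 ≤ R)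
    (hq : R * L ^ α * √(V / n) ≤ q) :
    R ^ (k + 2) * ((k + 2).factorial : ℝ) ^ (α - 1) * (√V ^ (k + 1) / √(n.choose (k + 2))) ≤
      2 ^ (α - 1) * (2 * R ^ 2 * (√V / n)) * q ^ k := by
  set y : ℝ := √(k + 2 : ℕ)
  have hy : 0 < y := Real.sqrt_pos.2 (by positivity)
  have hyy : y * y = (k + 2 : ℕ) := Real.mul_self_sqrt (by positivity)
  have hn : 0 < √(n : ℝ) := Real.sqrt_pos.2 (by exact_mod_cast (by omega : 0 < n))
  have hL : 0 < L := lt_of_lt_of_le (by positivity) hk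
  have hfac : ((k + 2).factorial : ℝ) ^ (α - 1) ≤ 2 ^ (α - 1) * (L ^ (α - 1)) ^ k := by
    simpa [add_comm] using factorial_add_rpow_le (l := 2) (m := k) (sub_nonneg.2 hα)
      (by rwa [add_comm])
  have hbase : R * L ^ (α - 1) * (√V / √n) * y ≤ q / y := by
    rw [le_div_iff₀ hy, mul_assoc, hyy]
    calc R * L ^ (α - 1) * (√V / √n) * (k + 2 : ℕ) ≤ R * L ^ (α - 1) * (√V / √n) * L := by gcongr
      _ = R * L ^ α * √(V / n) := by
        rw [Real.sqrt_div' V n.cast_nonneg, Real.rpow_sub_one hL.ne']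
        field_simp
      _ ≤ q := hq
  calc R ^ (k + 2) * ((k + 2).factorial : ℝ) ^ (α - 1) * (√V ^ (k + 1) / √(n.choose (k + 2)))
      ≤ R ^ (k + 2) * (2 ^ (α - 1) * (L ^ (α - 1)) ^ k) *
          (√V ^ (k + 1) * (y / √n) ^ (k + 2)) := by
        rw [div_eq_mul_inv _ √(n.choose (k + 2) : ℝ)]
        gcongr
        exact inv_sqrt_choose_le hkn
    _ = 2 ^ (α - 1) * (R ^ 2 * (√V / (√n * √n))) * (y * y) *
          (R * L ^ (α - 1) * (√V / √n) * y) ^ k := by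
        simp only [div_pow, mul_pow, pow_add, pow_one, pow_two]
        field_simp
    _ ≤ 2 ^ (α - 1) * (R ^ 2 * (√V / (√n * √n))) * (2 * y ^ k) * (q / y) ^ k := by
        have hyk : y * y ≤ 2 * y ^ k := hyy.trans_le (add_two_le_two_mul_sqrt_pow k)
        exact mul_le_mul (mul_le_mul_of_nonneg_left hyk (by positivity))
          (pow_le_pow_left₀ (by positivity) hbase k) (by positivity) (by positivity)
    _ = 2 ^ (α - 1) * (2 * R ^ 2 * (√V / n)) * q ^ k := by
        rw [Real.mul_self_sqrt n.cast_nonneg, div_pow]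
        field_simp

end Numerics

section Gevrey

variable {E F : Type*} [NormedAddCommGroup E] [NormedSpace ℝ E] [NormedAddCommGroup F]
  [NormedSpace ℝ F]

open scoped ContDiff in
/-- The pointwise form of the Gevrey condition of order `α` and radius parameter `R`: `f` is smooth
at `x`, and `K` bounds the Gevrey semi-norm of `f` at `x`. -/
structure IsGevreyAt (α R K : ℝ) (f : E → F) (x : E) : Prop where
  contDiffAt : ContDiffAt ℝ ∞ f x
  norm_iteratedFDeriv_le (k : ℕ) :
    ‖iteratedFDeriv ℝ k f x‖ ≤ K * (R ^ k * (k.factorial : ℝ) ^ α)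

lemma IsGevreyAt.nonneg {α R K : ℝ} {f : E → F} {x : E} (hf : IsGevreyAt α R K f x) : 0 ≤ K := by
  simpa using (norm_nonneg _).trans (hf.norm_iteratedFDeriv_le 0)

lemma IsGevreyAt.norm_fderiv_le {α R K : ℝ} {f : E → F} {x : E} (hf : IsGevreyAt α R K f x) :
    ‖fderiv ℝ f x‖ ≤ K * R := by
  simpa [norm_iteratedFDeriv_one] using hf.norm_iteratedFDeriv_le 1

lemma isGevreyAt_of_gevreyNorm_lt_top {α R : ℝ} (hR : 0 < R) {U : Set E} {f : E → ℝ}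
    (hf : SmoothOn U f) (hfin : gevreyNorm α R U f < ⊤) {x : E} (hx : x ∈ U) :
    IsGevreyAt α R (gevreyNorm α R U f).toReal f x := by
  refine ⟨hf x hx, fun k => ?_⟩
  have hk : ENNReal.ofReal (‖iteratedFDeriv ℝ k f x‖ / (R ^ k * (k.factorial : ℝ) ^ α)) ≤
      gevreyNorm α R U f := le_iSup₂_of_le x hx (le_iSup_of_le k le_rfl)
  rw [ENNReal.ofReal_le_iff_le_toReal hfin.ne, div_le_iff₀ (by positivity)] at hk
  exact hk

variable {α R K L r q : ℝ} {f : E → F} {s : ℕ} {t θ : E}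

lemma IsGevreyAt.norm_taylorForm_div_le (hf : IsGevreyAt α R K f t) (hα : 1 ≤ α) (hR : 0 ≤ R)
    (ht : ‖θ - t‖ ≤ r) (hs : (s : ℝ) ≤ L) (hq : R * r * L ^ (α - 1) ≤ q) (hq1 : q < 1) (l : ℕ) :
    ‖taylorForm f s t θ l‖ / l.factorial ≤
      K * (R ^ l * (l.factorial : ℝ) ^ (α - 1)) / (1 - q) ^ (l + 1) := by
  have hK := hf.nonneg
  have hr : 0 ≤ r := (norm_nonneg _).trans ht
  have hL : 0 ≤ L := s.cast_nonneg.trans hs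
  have hterm : ∀ m ∈ Finset.range (s + 1 - l),
      ‖(m.factorial : ℝ)⁻¹ • fixFirst (θ - t) (iteratedFDeriv ℝ (m + l) f t)‖ ≤
        K * (R ^ l * (l.factorial : ℝ) ^ (α - 1)) * l.factorial *
          ((m + l).choose l * (R * r * L ^ (α - 1)) ^ m) := by
    intro m hm
    have hml : ((l + m : ℕ) : ℝ) ≤ L :=
      le_trans (by exact_mod_cast (by have := Finset.mem_range.1 hm; omega)) hs
    calc ‖(m.factorial : ℝ)⁻¹ • fixFirst (θ - t) (iteratedFDeriv ℝ (m + l) f t)‖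
        = (m.factorial : ℝ)⁻¹ * ‖fixFirst (θ - t) (iteratedFDeriv ℝ (m + l) f t)‖ := by
          rw [norm_smul, norm_inv, Real.norm_natCast]
      _ ≤ (m.factorial : ℝ)⁻¹ * (K * (R ^ (m + l) * ((m + l).factorial *
            ((l.factorial : ℝ) ^ (α - 1) * (L ^ (α - 1)) ^ m))) * r ^ m) := by
          gcongr
          refine (norm_fixFirst_apply_le _ _).trans ?_
          gcongr
          refine (hf.norm_iteratedFDeriv_le _).trans ?_
          rw [factorial_rpow_eq_mul, add_comm m l]
          gcongr
          exact factorial_add_rpow_le (sub_nonneg.2 hα) hml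
      _ = _ := by
          rw [← Nat.add_choose_mul_factorial_mul_factorial m l]
          push_cast
          simp only [mul_pow, pow_add]
          field_simp
  rw [div_le_iff₀ (by positivity)]
  calc ‖taylorForm f s t θ l‖
      ≤ ∑ m ∈ Finset.range (s + 1 - l), K * (R ^ l * (l.factorial : ℝ) ^ (α - 1)) *
          l.factorial * ((m + l).choose l * (R * r * L ^ (α - 1)) ^ m) := norm_sum_le_of_le _ hterm
    _ ≤ K * (R ^ l * (l.factorial : ℝ) ^ (α - 1)) * l.factorial * (1 / (1 - q) ^ (l + 1)) := by
        rw [← Finset.mul_sum]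
        gcongr
        exact sum_choose_mul_pow_le (by positivity) hq hq1 l _
    _ = _ := by ring

lemma norm_iteratedFDeriv_sub_taylorForm_le_of_isGevreyAt {l : ℕ} (hl : l ≤ s)
    (hf : ∀ x ∈ Metric.closedBall θ r, IsGevreyAt α R K f x) (hα : 1 ≤ α) (hR : 0 ≤ R)
    (ht : t ∈ Metric.closedBall θ r) (hs : s ≠ 0) (hsL : (s : ℝ) ≤ L)
    (hq : R * r * L ^ (α - 1) ≤ q) :
    r ^ l * ‖iteratedFDeriv ℝ l f θ - taylorForm f s t θ l‖ ≤
      K * (2 ^ (α - 1) * q ^ s) * (R * r) * ((s + 1).factorial / (s + 1 - l).factorial) := by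
  have hK := (hf t ht).nonneg
  have htr : ‖θ - t‖ ≤ r := by rwa [← dist_eq_norm, dist_comm]
  have hr : 0 ≤ r := (norm_nonneg _).trans htr
  have hL : 0 ≤ L := s.cast_nonneg.trans hsL
  have hseg : segment ℝ t θ ⊆ Metric.closedBall θ r :=
    (convex_closedBall θ r).segment_subset ht (Metric.mem_closedBall_self hr)
  have htaylor := norm_iteratedFDeriv_sub_taylorForm_le hl
    (fun x hx => (hf x (hseg hx)).contDiffAt.of_le (by exact_mod_cast le_top))
    (fun x hx => (hf x (hseg hx)).norm_iteratedFDeriv_le (s + 1))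
  calc r ^ l * ‖iteratedFDeriv ℝ l f θ - taylorForm f s t θ l‖
      ≤ r ^ l * (K * (R ^ (s + 1) * ((s + 1).factorial : ℝ) ^ α) * r ^ (s + 1 - l) /
          (s + 1 - l).factorial) := by
        gcongr
        refine htaylor.trans ?_
        gcongr
    _ = K * ((R * r) ^ s * ((s + 1).factorial : ℝ) ^ (α - 1)) * (R * r) *
          ((s + 1).factorial / (s + 1 - l).factorial) := by
        rw [factorial_rpow_eq_mul]
        have hrpow : r ^ l * r ^ (s + 1 - l) = r ^ (s + 1) := by rw [← pow_add]; congr 1; omega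
        linear_combination (K * R ^ (s + 1) * ((s + 1).factorial *
          ((s + 1).factorial : ℝ) ^ (α - 1)) / (s + 1 - l).factorial) * hrpow
    _ ≤ K * ((R * r) ^ s * (2 ^ (α - 1) * (L ^ (α - 1)) ^ s)) * (R * r) *
          ((s + 1).factorial / (s + 1 - l).factorial) := by
        gcongr
        exact factorial_succ_rpow_le (sub_nonneg.2 hα) hs hsL
    _ = K * (2 ^ (α - 1) * (R * r * L ^ (α - 1)) ^ s) * (R * r) *
          ((s + 1).factorial / (s + 1 - l).factorial) := by rw [mul_pow (R * r)]; ring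
    _ ≤ _ := by gcongr

end Gevrey

section TruncationLevel

variable {n : ℕ}

lemma log_exp_one_mul (hn : n ≠ 0) : Real.log (Real.exp 1 * n) = 1 + Real.log n := by
  rw [Real.log_mul (Real.exp_pos 1).ne' (by exact_mod_cast hn), Real.log_exp]

lemma one_le_log_exp_one_mul (hn : n ≠ 0) : 1 ≤ Real.log (Real.exp 1 * n) := by
  rw [log_exp_one_mul hn]
  exact le_add_of_nonneg_right (Real.log_natCast_nonneg n)

lemma truncLevel_le_log (hn : n ≠ 0) : (truncLevel n : ℝ) ≤ Real.log (Real.exp 1 * n) :=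
  Nat.floor_le (zero_le_one.trans (one_le_log_exp_one_mul hn))

lemma truncLevel_ne_zero (hn : n ≠ 0) : truncLevel n ≠ 0 :=
  Nat.one_le_iff_ne_zero.1 (Nat.le_floor (by exact_mod_cast one_le_log_exp_one_mul hn))

lemma truncLevel_le (hn : n ≠ 0) : truncLevel n ≤ n := by
  have hle := truncLevel_le_log hn
  have hlog := Real.log_le_sub_one_of_pos (show (0 : ℝ) < n by exact_mod_cast hn.bot_lt)
  rw [log_exp_one_mul hn] at hle
  exact_mod_cast (show (truncLevel n : ℝ) ≤ n by linarith)

lemma exp_inv_pow_truncLevel_le (hn : n ≠ 0) : (Real.exp 1)⁻¹ ^ truncLevel n ≤ 1 / n := by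
  have hn0 : (0 : ℝ) < n := by exact_mod_cast hn.bot_lt
  have hlog : Real.log n ≤ truncLevel n := by
    have hlt := Nat.lt_floor_add_one (Real.log (Real.exp 1 * n))
    rw [truncLevel]
    linarith [log_exp_one_mul hn]
  rw [inv_pow, ← Real.exp_nat_mul, mul_one, one_div]
  gcongr
  exact (Real.log_le_iff_le_exp hn0).1 hlog

lemma truncLevel_add_one_div_le (hn : n ≠ 0) :
    (truncLevel n + 1 : ℝ) / n ≤ 6 / (n : ℝ) ^ (3 / 4 : ℝ) := by
  have hn0 : (0 : ℝ) < n := by exact_mod_cast hn.bot_lt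
  have hle := truncLevel_le_log hn
  rw [log_exp_one_mul hn] at hle
  have hlog : Real.log n ≤ (n : ℝ) ^ (1 / 4 : ℝ) / (1 / 4) :=
    Real.log_le_rpow_div hn0.le (by norm_num)
  have hone : (1 : ℝ) ≤ (n : ℝ) ^ (1 / 4 : ℝ) :=
    Real.one_le_rpow (by exact_mod_cast hn.bot_lt) (by norm_num)
  have hsplit : (n : ℝ) ^ (1 / 4 : ℝ) * (n : ℝ) ^ (3 / 4 : ℝ) = n := by
    rw [← Real.rpow_add hn0]
    norm_num
  calc (truncLevel n + 1 : ℝ) / n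
      ≤ 6 * (n : ℝ) ^ (1 / 4 : ℝ) / ((n : ℝ) ^ (1 / 4 : ℝ) * (n : ℝ) ^ (3 / 4 : ℝ)) := by
        rw [hsplit]
        gcongr
        linarith
    _ = 6 / (n : ℝ) ^ (3 / 4 : ℝ) := by
        field_simp

end TruncationLevel

section Risk

lemma eLpNorm_add_le_ofReal_add {X : Type*} [MeasurableSpace X] {μ : Measure X} {g h : X → ℝ}
    {a b : ℝ} (ha : 0 ≤ a) (hb : 0 ≤ b) (hg : AEStronglyMeasurable g μ)
    (hh : AEStronglyMeasurable h μ) (hga : eLpNorm g 2 μ ≤ ENNReal.ofReal a)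
    (hhb : eLpNorm h 2 μ ≤ ENNReal.ofReal b) :
    eLpNorm (fun x => g x + h x) 2 μ ≤ ENNReal.ofReal (a + b) := by
  rw [ENNReal.ofReal_add ha hb]
  exact (eLpNorm_add_le hg hh one_le_two).trans (add_le_add hga hhb)

variable {B : Type*} [NormedAddCommGroup B] [NormedSpace ℝ B]

lemma oneSided_sub_linearization_eq {n s : ℕ} {f : B → ℝ} {t : B} (hs0 : s ≠ 0) (hs : s ≤ n)
    (hf : ContDiffAt ℝ s f t) (w : Fin n → B) (θ : B) :
    oneSided f s w t - f θ - fderiv ℝ f θ (sampleMean w - θ) =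
      uStat (taylorForm f s t θ 0 - iteratedFDeriv ℝ 0 f θ) w θ +
        uStat (taylorForm f s t θ 1 - iteratedFDeriv ℝ 1 f θ) w θ +
        ∑ k ∈ Finset.range (s - 1), uStat (taylorForm f s t θ (k + 2)) w θ / (k + 2).factorial := by
  obtain ⟨m, rfl⟩ := Nat.exists_eq_succ_of_ne_zero hs0
  have hn : n ≠ 0 := by omega
  rw [oneSided_eq_sum_uStat_taylorForm hs hf w θ, Finset.sum_range_succ', Finset.sum_range_succ',
    uStat_sub, uStat_sub, uStat_fin_zero (iteratedFDeriv ℝ 0 f θ),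
    uStat_fin_one hn (iteratedFDeriv ℝ 1 f θ), iteratedFDeriv_zero_apply,
    iteratedFDeriv_one_apply, Nat.succ_sub_one]
  simp only [zero_add, Nat.factorial_zero, Nat.factorial_one, Nat.cast_one, div_one, add_assoc,
    Nat.reduceAdd]
  ring

variable [MeasurableSpace B] {P : Measure B} [IsProbabilityMeasure P]
  {n s : ℕ} {f : B → ℝ} {t : B} {α R K L r q : ℝ}

lemma eLpNorm_uStat_fin_zero_le (T : B [×0]→L[ℝ] ℝ) (b : B) :
    eLpNorm (fun x : Fin n → B => uStat T x b) 2 (Measure.pi fun _ => P) ≤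
      ENNReal.ofReal ‖T‖ := by
  refine (eLpNorm_le_of_ae_bound (C := ‖T‖) (ae_of_all _ fun x => ?_)).trans (by simp)
  rw [uStat_fin_zero]
  exact (T.le_opNorm 0).trans_eq (by simp)

lemma eLpNorm_uStat_taylorForm_zero_sub_le
    (hf : ∀ x ∈ Metric.closedBall (mean P) r, IsGevreyAt α R K f x) (hα : 1 ≤ α) (hR : 0 ≤ R)
    (ht : t ∈ Metric.closedBall (mean P) r) (hs : s ≠ 0) (hsL : (s : ℝ) ≤ L)
    (hqr : R * r * L ^ (α - 1) ≤ q) :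
    eLpNorm (fun x : Fin n → B => uStat (taylorForm f s t (mean P) 0 -
        iteratedFDeriv ℝ 0 f (mean P)) x (mean P)) 2 (Measure.pi fun _ => P) ≤
      ENNReal.ofReal (K * 2 ^ (α - 1) * (q ^ s * (R * r))) := by
  refine (eLpNorm_uStat_fin_zero_le _ _).trans (ENNReal.ofReal_le_ofReal ?_)
  have hrem := norm_iteratedFDeriv_sub_taylorForm_le_of_isGevreyAt s.zero_le hf hα hR ht hs hsL hqr
  rw [pow_zero, one_mul, norm_sub_rev, Nat.sub_zero, div_self (by positivity), mul_one] at hrem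
  exact hrem.trans_eq (by ring)

variable [CompleteSpace B]

lemma eLpNorm_uStat_fin_one_le (hP : MemLp id 2 P) (T : B [×1]→L[ℝ] ℝ) :
    eLpNorm (fun x : Fin n → B => uStat T x (mean P)) 2 (Measure.pi fun _ => P) ≤
      ENNReal.ofReal (‖T‖ * (√(weakVar P) / √n)) := by
  simpa using eLpNorm_uStat_le (n := n) (k := 0) hP T

lemma eLpNorm_dual_sampleMean_sub_mean_le (hn : n ≠ 0) (hP : MemLp id 2 P)
    (u : StrongDual ℝ B) :
    eLpNorm (fun x : Fin n → B => u (sampleMean x - mean P)) 2 (Measure.pi fun _ => P) ≤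
      ENNReal.ofReal (‖u‖ * (√(weakVar P) / √n)) := by
  have hu := eLpNorm_uStat_fin_one_le (n := n) hP
    (ContinuousMultilinearMap.ofSubsingleton ℝ B ℝ (0 : Fin 1) u)
  simpa only [uStat_fin_one hn, ContinuousMultilinearMap.ofSubsingleton_apply_apply,
    ContinuousMultilinearMap.norm_ofSubsingleton] using hu

lemma eLpNorm_uStat_taylorForm_div_factorial_le {k : ℕ} (hP : MemLp id 2 P)
    (hf : IsGevreyAt α R K f t) (hα : 1 ≤ α) (hR : 0 ≤ R) (ht : ‖mean P - t‖ ≤ r) (hks : k + 2 ≤ s)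
    (hsn : s ≤ n) (hsL : (s : ℝ) ≤ L) (hqr : R * r * L ^ (α - 1) ≤ q)
    (hqV : R * L ^ α * √(strongVar P / n) ≤ q) (hq : q < 1) :
    eLpNorm (fun x : Fin n → B => uStat (taylorForm f s t (mean P) (k + 2)) x (mean P) /
        (k + 2).factorial) 2 (Measure.pi fun _ => P) ≤
      ENNReal.ofReal (K * 2 ^ (α - 1) * (2 * R ^ 2 * (√(weakVar P) * √(strongVar P) / n) /
        (1 - q) ^ 3) * (q / (1 - q)) ^ k) := by
  have hK := hf.nonneg
  have hq1 : 0 < 1 - q := by linarith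
  have hscale (x : Fin n → B) : uStat (taylorForm f s t (mean P) (k + 2)) x (mean P) /
      (k + 2).factorial =
        uStat (((k + 2).factorial : ℝ)⁻¹ • taylorForm f s t (mean P) (k + 2)) x (mean P) := by
    rw [uStat_smul, div_eq_inv_mul]
  simp only [hscale]
  refine (eLpNorm_uStat_le (k := k + 1) hP _).trans (ENNReal.ofReal_le_ofReal ?_)
  rw [norm_smul, norm_inv, Real.norm_natCast, ← div_eq_inv_mul]
  have hk2 : ((k + 2 : ℕ) : ℝ) ≤ L := le_trans (by exact_mod_cast hks) hsL
  have hform := hf.norm_taylorForm_div_le hα hR ht hsL hqr hq (k + 2)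
  have hrate := pow_mul_factorial_rpow_mul_sqrt_pow_div_sqrt_choose_le hk2 (hks.trans hsn) hα hR hqV
  calc ‖taylorForm f s t (mean P) (k + 2)‖ / (k + 2).factorial *
        (√(weakVar P) * √(strongVar P) ^ (k + 1) / √(n.choose (k + 2)))
      ≤ K * (R ^ (k + 2) * ((k + 2).factorial : ℝ) ^ (α - 1)) / (1 - q) ^ (k + 2 + 1) *
        (√(weakVar P) * √(strongVar P) ^ (k + 1) / √(n.choose (k + 2))) :=
        mul_le_mul_of_nonneg_right hform (by positivity)
    _ = K * √(weakVar P) / (1 - q) ^ (k + 3) * (R ^ (k + 2) * ((k + 2).factorial : ℝ) ^ (α - 1) *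
        (√(strongVar P) ^ (k + 1) / √(n.choose (k + 2)))) := by ring
    _ ≤ K * √(weakVar P) / (1 - q) ^ (k + 3) *
        (2 ^ (α - 1) * (2 * R ^ 2 * (√(strongVar P) / n)) * q ^ k) :=
        mul_le_mul_of_nonneg_left hrate (by positivity)
    _ = _ := by
        rw [div_pow, pow_add (1 - q) k 3]
        field_simp

lemma eLpNorm_sum_uStat_taylorForm_le (hP : MemLp id 2 P)
    (hf : IsGevreyAt α R K f t) (hα : 1 ≤ α) (hR : 0 ≤ R) (ht : ‖mean P - t‖ ≤ r)
    (hsn : s ≤ n) (hsL : (s : ℝ) ≤ L) (hqr : R * r * L ^ (α - 1) ≤ q)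
    (hqV : R * L ^ α * √(strongVar P / n) ≤ q) (hq : q < 1 / 2) :
    eLpNorm (fun x : Fin n → B => ∑ k ∈ Finset.range (s - 1),
        uStat (taylorForm f s t (mean P) (k + 2)) x (mean P) / (k + 2).factorial) 2
        (Measure.pi fun _ => P) ≤
      ENNReal.ofReal (K * 2 ^ (α - 1) * (2 * R ^ 2 * (√(weakVar P) * √(strongVar P) / n) /
        ((1 - q) ^ 2 * (1 - 2 * q)))) := by
  have hK := hf.nonneg
  have hL : 0 ≤ L := s.cast_nonneg.trans hsL
  have hr : 0 ≤ r := (norm_nonneg _).trans ht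
  have hq0 : 0 ≤ q := le_trans (by positivity) hqr
  have hq1 : 0 < 1 - q := by linarith
  set M := K * 2 ^ (α - 1) * (2 * R ^ 2 * (√(weakVar P) * √(strongVar P) / n) / (1 - q) ^ 3)
    with hM
  have : 0 ≤ M := by positivity
  calc _ ≤ ∑ k ∈ Finset.range (s - 1), ENNReal.ofReal (M * (q / (1 - q)) ^ k) := by
        rw [← Finset.sum_fn]
        refine (eLpNorm_sum_le (fun k _ => ?_) one_le_two).trans
          (Finset.sum_le_sum fun k hk => ?_)
        · simpa only [div_eq_mul_inv] using (memLp_uStat hP _).aestronglyMeasurable.mul_const _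
        · have hks : k + 2 ≤ s := by
            have := Finset.mem_range.1 hk
            omega
          exact eLpNorm_uStat_taylorForm_div_factorial_le hP hf hα hR ht hks hsn hsL hqr hqV
            (by linarith)
    _ = ENNReal.ofReal (M * ∑ k ∈ Finset.range (s - 1), (q / (1 - q)) ^ k) := by
        rw [← ENNReal.ofReal_sum_of_nonneg fun k _ => by positivity, ← Finset.mul_sum]
    _ ≤ ENNReal.ofReal (M * ((1 - q) / (1 - 2 * q))) := by
        gcongr
        exact sum_div_one_sub_pow_le hq0 hq _
    _ = _ := by
        rw [hM]
        congr 1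
        field_simp

lemma eLpNorm_uStat_taylorForm_one_sub_le (hP : MemLp id 2 P)
    (hf : ∀ x ∈ Metric.closedBall (mean P) r, IsGevreyAt α R K f x) (hα : 1 ≤ α) (hR : 0 ≤ R)
    (hr : 0 < r) (ht : t ∈ Metric.closedBall (mean P) r) (hs : s ≠ 0) (hsL : (s : ℝ) ≤ L)
    (hqr : R * r * L ^ (α - 1) ≤ q) :
    eLpNorm (fun x : Fin n → B => uStat (taylorForm f s t (mean P) 1 -
        iteratedFDeriv ℝ 1 f (mean P)) x (mean P)) 2 (Measure.pi fun _ => P) ≤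
      ENNReal.ofReal (K * 2 ^ (α - 1) * (q ^ s * (R * (s + 1)) * (√(weakVar P) / √n))) := by
  refine (eLpNorm_uStat_fin_one_le hP _).trans (ENNReal.ofReal_le_ofReal ?_)
  rw [← mul_assoc]
  refine mul_le_mul_of_nonneg_right (le_of_mul_le_mul_left ?_ hr) (by positivity)
  have hrem := norm_iteratedFDeriv_sub_taylorForm_le_of_isGevreyAt (Nat.one_le_iff_ne_zero.2 hs)
    hf hα hR ht hs hsL hqr
  rw [pow_one, norm_sub_rev, Nat.add_sub_cancel, Nat.factorial_succ, Nat.cast_mul,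
    mul_div_cancel_right₀ _ (by positivity)] at hrem
  refine hrem.trans_eq ?_
  push_cast
  ring

theorem eLpNorm_oneSided_sub_linearization_le (hP : MemLp id 2 P)
    (hf : ∀ x ∈ Metric.closedBall (mean P) r, IsGevreyAt α R K f x) (hα : 1 ≤ α) (hR : 0 ≤ R)
    (hr : 0 < r) (ht : t ∈ Metric.closedBall (mean P) r) (hs : s ≠ 0) (hsn : s ≤ n)
    (hsL : (s : ℝ) ≤ L) (hqr : R * r * L ^ (α - 1) ≤ q)
    (hqV : R * L ^ α * √(strongVar P / n) ≤ q) (hq : q < 1 / 2) :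
    eLpNorm (fun x : Fin n → B => oneSided f s x t - f (mean P) -
        fderiv ℝ f (mean P) (sampleMean x - mean P)) 2 (Measure.pi fun _ => P) ≤
      ENNReal.ofReal (K * 2 ^ (α - 1) * (q ^ s * (R * r) +
        q ^ s * (R * (s + 1)) * (√(weakVar P) / √n) +
        2 * R ^ 2 * (√(weakVar P) * √(strongVar P) / n) / ((1 - q) ^ 2 * (1 - 2 * q)))) := by
  have hK := (hf t ht).nonneg
  have htr : ‖mean P - t‖ ≤ r := by rwa [← dist_eq_norm, dist_comm]
  have hL : 0 ≤ L := s.cast_nonneg.trans hsL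
  have hq0 : 0 ≤ q := le_trans (by positivity) hqr
  have hq2 : 0 ≤ 1 - 2 * q := by linarith
  have hmeas {k : ℕ} (G : B [×k]→L[ℝ] ℝ) : AEStronglyMeasurable
      (fun x : Fin n → B => uStat G x (mean P)) (Measure.pi fun _ => P) :=
    (memLp_uStat hP G).aestronglyMeasurable
  simp only [oneSided_sub_linearization_eq hs hsn ((hf t ht).contDiffAt.of_le
    (by exact_mod_cast le_top))]
  rw [mul_add, mul_add]
  refine eLpNorm_add_le_ofReal_add (by positivity) (by positivity) ((hmeas _).add (hmeas _)) ?_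
    (eLpNorm_add_le_ofReal_add (by positivity) (by positivity) (hmeas _) (hmeas _) ?_ ?_) ?_
  · simp only [div_eq_mul_inv]
    exact Finset.aestronglyMeasurable_fun_sum _ fun k _ => (hmeas _).mul_const _
  · exact eLpNorm_uStat_taylorForm_zero_sub_le hf hα hR ht hs hsL hqr
  · exact eLpNorm_uStat_taylorForm_one_sub_le hP hf hα hR hr ht hs hsL hqr
  · exact eLpNorm_sum_uStat_taylorForm_le hP (hf t ht) hα hR htr hsn hsL hqr hqV hq

theorem eLpNorm_oneSided_truncLevel_sub_linearization_le (hn : n ≠ 0) (hP : MemLp id 2 P)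
    (hf : ∀ x ∈ Metric.closedBall (mean P) r, IsGevreyAt α R K f x) (hα : 1 ≤ α) (hR : 0 ≤ R)
    (hr : 0 < r) (ht : t ∈ Metric.closedBall (mean P) r)
    (hRr : R * r * Real.log (Real.exp 1 * n) ^ (α - 1) ≤ (Real.exp 1)⁻¹)
    (hRV : R * Real.log (Real.exp 1 * n) ^ α * √(strongVar P / n) ≤ (Real.exp 1)⁻¹) :
    eLpNorm (fun x : Fin n → B => oneSided f (truncLevel n) x t - f (mean P) -
        fderiv ℝ f (mean P) (sampleMean x - mean P)) 2 (Measure.pi fun _ => P) ≤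
      ENNReal.ofReal (K * 2 ^ (α - 1) * (R * r / n +
        6 * R * (√(weakVar P) / √n) / (n : ℝ) ^ (3 / 4 : ℝ) +
        28 * R ^ 2 * (√(weakVar P) * √(strongVar P) / n))) := by
  have hK := (hf t ht).nonneg
  have hq : (Real.exp 1)⁻¹ ≤ 2 / 5 :=
    inv_le_of_inv_le₀ (by norm_num) (by linarith [Real.exp_one_gt_d9])
  refine (eLpNorm_oneSided_sub_linearization_le hP hf hα hR hr ht (truncLevel_ne_zero hn)
    (truncLevel_le hn) (truncLevel_le_log hn) hRr hRV (by linarith)).trans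
    (ENNReal.ofReal_le_ofReal ?_)
  set q := (Real.exp 1)⁻¹
  have hbias : q ^ truncLevel n ≤ 1 / n := exp_inv_pow_truncLevel_le hn
  have hconst : 1 / 14 ≤ (1 - q) ^ 2 * (1 - 2 * q) := by
    calc (1 / 14 : ℝ) ≤ (3 / 5) ^ 2 * (1 / 5) := by norm_num
      _ ≤ (1 - q) ^ 2 * (1 - 2 * q) := by gcongr <;> linarith
  have hslope := truncLevel_add_one_div_le hn
  gcongr K * 2 ^ (α - 1) * (?_ + ?_ + ?_)
  · calc q ^ truncLevel n * (R * r) ≤ 1 / n * (R * r) := by gcongr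
      _ = R * r / n := by ring
  · calc q ^ truncLevel n * (R * (truncLevel n + 1)) * (√(weakVar P) / √n)
        ≤ 1 / n * (R * (truncLevel n + 1)) * (√(weakVar P) / √n) := by gcongr
      _ = R * ((truncLevel n + 1) / n) * (√(weakVar P) / √n) := by ring
      _ ≤ R * (6 / (n : ℝ) ^ (3 / 4 : ℝ)) * (√(weakVar P) / √n) :=
        mul_le_mul_of_nonneg_right (mul_le_mul_of_nonneg_left hslope hR) (by positivity)
      _ = _ := by ring
  · calc 2 * R ^ 2 * (√(weakVar P) * √(strongVar P) / n) / ((1 - q) ^ 2 * (1 - 2 * q))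
        ≤ 2 * R ^ 2 * (√(weakVar P) * √(strongVar P) / n) / (1 / 14) := by gcongr
      _ = _ := by ring

end Risk

section IndependentPilot

variable {X Y T F : Type*} [MeasurableSpace X] [MeasurableSpace Y] [NormedAddCommGroup F]
  {μ : Measure X} {ν : Measure Y} {p c : ENNReal} {A : Set T} {g : Y → T} {H : X → T → F}

lemma eLpNorm_le_iff_lintegral_rpow_enorm_le (hp0 : p ≠ 0) (hp : p ≠ ⊤) {h : X → F} :
    eLpNorm h p μ ≤ c ↔ ∫⁻ x, ‖h x‖ₑ ^ p.toReal ∂μ ≤ c ^ p.toReal := by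
  rw [eLpNorm_eq_lintegral_rpow_enorm_toReal hp0 hp, one_div,
    ENNReal.rpow_inv_le_iff (ENNReal.toReal_pos hp0 hp)]

lemma eLpNorm_prod_le_of_forall [SFinite μ] [IsProbabilityMeasure ν] (hp0 : p ≠ 0) (hp : p ≠ ⊤)
    {h : X × Y → F} (hh : AEStronglyMeasurable h (μ.prod ν))
    (hc : ∀ y, eLpNorm (fun x => h (x, y)) p μ ≤ c) : eLpNorm h p (μ.prod ν) ≤ c := by
  rw [eLpNorm_le_iff_lintegral_rpow_enorm_le hp0 hp,
    lintegral_prod_symm _ (hh.enorm.pow_const _)]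
  calc ∫⁻ y, ∫⁻ x, ‖h (x, y)‖ₑ ^ p.toReal ∂μ ∂ν ≤ ∫⁻ _, c ^ p.toReal ∂ν :=
        lintegral_mono fun y => (eLpNorm_le_iff_lintegral_rpow_enorm_le hp0 hp).1 (hc y)
    _ = c ^ p.toReal := by simp

lemma aestronglyMeasurable_indicator_comp [TopologicalSpace T]
    [TopologicalSpace.PseudoMetrizableSpace T] (hg : AEStronglyMeasurable g ν)
    (hA : IsClosed A) {h : T → ℝ} (hh : ContinuousOn h A) :
    AEStronglyMeasurable (A.indicator h ∘ g) ν := by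
  classical
  borelize T
  have hmeas : Measurable (A.indicator h) := by
    rw [← Set.piecewise_eq_indicator]
    exact hh.measurable_piecewise continuousOn_const hA.measurableSet
  exact (hmeas.comp_aemeasurable hg.aemeasurable).aestronglyMeasurable

lemma eLpNorm_indicator_pilot_le [SFinite μ] [IsProbabilityMeasure ν] (hp0 : p ≠ 0) (hp : p ≠ ⊤)
    (hm : AEStronglyMeasurable ((fun z : X × Y => g z.2) ⁻¹' A |>.indicator
      fun z => H z.1 (g z.2)) (μ.prod ν))
    (hc : ∀ t ∈ A, eLpNorm (fun x => H x t) p μ ≤ c) :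
    eLpNorm ((fun z : X × Y => g z.2) ⁻¹' A |>.indicator fun z => H z.1 (g z.2)) p (μ.prod ν) ≤
      c := by
  refine eLpNorm_prod_le_of_forall hp0 hp hm fun y => ?_
  by_cases hy : g y ∈ A
  · simpa only [Set.indicator, Set.mem_preimage, hy, if_true] using hc _ hy
  · simp only [Set.indicator, Set.mem_preimage, hy, if_false, eLpNorm_zero', zero_le]

variable {Ω : Type*} [MeasurableSpace Ω] {m : Measure Ω}

theorem eLpNorm_indicator_independent_pilot_le [TopologicalSpace X]
    [TopologicalSpace.PseudoMetrizableSpace X] [TopologicalSpace T]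
    [TopologicalSpace.PseudoMetrizableSpace T] [SFinite μ] [IsProbabilityMeasure ν]
    {H : X → T → ℝ} {Z : Ω → X × Y} {S : Set Ω} (hp0 : p ≠ 0) (hp : p ≠ ⊤)
    (hZ : HasLaw Z (μ.prod ν) m) (hμ : AEStronglyMeasurable id μ)
    (hg : AEStronglyMeasurable g ν) (hA : IsClosed A)
    (hH : ContinuousOn (fun z : X × T => H z.1 z.2) (Set.univ ×ˢ A))
    (hc : ∀ t ∈ A, eLpNorm (fun x => H x t) p μ ≤ c) (hS : NullMeasurableSet S m)
    (hSA : ∀ ω ∈ S, g (Z ω).2 ∈ A) :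
    AEStronglyMeasurable (S.indicator fun ω => H (Z ω).1 (g (Z ω).2)) m ∧
      eLpNorm (S.indicator fun ω => H (Z ω).1 (g (Z ω).2)) p m ≤ c := by
  set h : X × Y → ℝ := (fun z => g z.2) ⁻¹' A |>.indicator fun z => H z.1 (g z.2) with hh
  have hm : AEStronglyMeasurable h (μ.prod ν) := by
    have hpair : AEStronglyMeasurable (fun z : X × Y => (z.1, g z.2)) (μ.prod ν) :=
      (hμ.comp_fst (ν := ν)).prodMk hg.comp_snd
    refine (aestronglyMeasurable_indicator_comp hpair (isClosed_univ.prod hA) hH).congr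
      (ae_of_all _ fun z => ?_)
    by_cases hz : g z.2 ∈ A <;> simp [hh, hz]
  have hle := eLpNorm_indicator_pilot_le hp0 hp hm hc
  have hind : (S.indicator fun ω => H (Z ω).1 (g (Z ω).2)) = S.indicator (h ∘ Z) :=
    Set.indicator_congr fun ω hω =>
      (Set.indicator_of_mem (s := (fun z : X × Y => g z.2) ⁻¹' A) (hSA ω hω)
        fun z => H z.1 (g z.2)).symm
  rw [← hZ.map_eq] at hm
  rw [hind]
  refine ⟨(hm.comp_aemeasurable hZ.aemeasurable).indicator₀ hS, (eLpNorm_indicator_le _).trans ?_⟩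
  rwa [← eLpNorm_map_measure hm hZ.aemeasurable, hZ.map_eq]

lemma eLpNorm_half_add_le [NormedSpace ℝ F] (hp : 1 ≤ p) {u v : Ω → F}
    (hu : AEStronglyMeasurable u m) (hv : AEStronglyMeasurable v m) (huc : eLpNorm u p m ≤ c)
    (hvc : eLpNorm v p m ≤ c) : eLpNorm ((2⁻¹ : ℝ) • (u + v)) p m ≤ c := by
  rw [eLpNorm_const_smul]
  calc ‖(2⁻¹ : ℝ)‖ₑ * eLpNorm (u + v) p m ≤ 2⁻¹ * (c + c) := by
        gcongr
        · exact by simp [Real.enorm_eq_ofReal]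
        · exact (eLpNorm_add_le hu hv hp).trans (add_le_add huc hvc)
    _ = c := by
        rw [← two_mul, ENNReal.inv_mul_cancel_left (by simp) (by simp)]

end IndependentPilot

section LinearizationError

variable {B : Type*} [NormedAddCommGroup B] [NormedSpace ℝ B] {n : ℕ}

lemma continuousOn_oneSided {f : B → ℝ} {A : Set B} (s : ℕ) (hf : ∀ t ∈ A, ContDiffAt ℝ s f t) :
    ContinuousOn (fun z : (Fin n → B) × B => oneSided f s z.1 z.2) (Set.univ ×ˢ A) := by
  intro z hz
  refine ContinuousAt.continuousWithinAt ?_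
  have hfz := hf z.2 hz.2
  refine (ContinuousAt.comp (f := Prod.snd) hfz.continuousAt continuousAt_snd).add
    (tendsto_finsetSum _ fun k hk => ?_)
  have hDk : ContinuousAt (fun z : (Fin n → B) × B => iteratedFDeriv ℝ k f z.2) z :=
    ContinuousAt.comp (f := Prod.snd) (hfz.continuousAt_iteratedFDeriv
      (by exact_mod_cast (Finset.mem_Icc.1 hk).2)) continuousAt_snd
  exact ContinuousAt.div_const (continuousAt_const.mul
    (tendsto_finsetSum _ fun j _ => hDk.eval (by fun_prop))) _

lemma continuous_sampleMean {N : ℕ} : Continuous (sampleMean : (Fin N → B) → B) := by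
  unfold sampleMean
  fun_prop

lemma sampleMean_eq_average_halves (w : Fin (n + n) → B) :
    sampleMean w = (2 : ℝ)⁻¹ • (sampleMean (firstHalf w) + sampleMean (secondHalf w)) := by
  simp only [sampleMean, firstHalf, secondHalf, Fin.sum_univ_add, ← smul_add, smul_smul]
  congr 1
  push_cast
  rw [← two_mul, mul_inv]

lemma crossFit_sub_linearization_eq (f : B → ℝ) (s : ℕ) (g₁ g₂ : (Fin n → B) → B)
    (w : Fin (n + n) → B) (θ : B) (u : StrongDual ℝ B) :
    crossFit f s g₁ g₂ w - f θ - u (sampleMean w - θ) =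
      ((oneSided f s (firstHalf w) (g₂ (secondHalf w)) - f θ - u (sampleMean (firstHalf w) - θ)) +
        (oneSided f s (secondHalf w) (g₁ (firstHalf w)) - f θ -
          u (sampleMean (secondHalf w) - θ))) / 2 := by
  simp only [crossFit, sampleMean_eq_average_halves, map_sub, map_smul, map_add, smul_eq_mul]
  ring

end LinearizationError

section CrossFitting

variable {B : Type*} [MeasurableSpace B] {P : Measure B} [IsProbabilityMeasure P] {n : ℕ}
  {Ω : Type*} [MeasurableSpace Ω] {μ : Measure Ω} {W : Fin (n + n) → Ω → B}

lemma measurePreserving_firstHalf : MeasurePreserving (firstHalf (n := n))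
    (Measure.pi fun _ => P) (Measure.pi fun _ => P) :=
  measurePreserving_precomp (Fin.castAdd_injective n n)

lemma measurePreserving_secondHalf : MeasurePreserving (secondHalf (n := n))
    (Measure.pi fun _ => P) (Measure.pi fun _ => P) :=
  measurePreserving_precomp (Fin.natAdd_injective n n)

lemma measurePreserving_halves :
    MeasurePreserving (fun w : Fin (n + n) → B => (firstHalf w, secondHalf w))
      (Measure.pi fun _ => P) ((Measure.pi fun _ => P).prod (Measure.pi fun _ => P)) :=
  (measurePreserving_sumPiEquivProdPi (fun _ : Fin n ⊕ Fin n => P)).comp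
    (measurePreserving_precomp (P := P) finSumFinEquiv.injective)

variable [NormedAddCommGroup B]

lemma nullMeasurableSet_pilotEvent (hW : HasLaw (fun ω i => W i ω) (Measure.pi fun _ => P) μ)
    {g₁ g₂ : (Fin n → B) → B} (hg₁ : AEStronglyMeasurable g₁ (Measure.pi fun _ => P))
    (hg₂ : AEStronglyMeasurable g₂ (Measure.pi fun _ => P)) (θ : B) (r : ℝ) :
    NullMeasurableSet (pilotEvent g₁ g₂ W θ r) μ := by
  have hnorm {h : (Fin (n + n) → B) → Fin n → B}
      (hh : MeasurePreserving h (Measure.pi fun _ => P) (Measure.pi fun _ => P))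
      {g : (Fin n → B) → B} (hg : AEStronglyMeasurable g (Measure.pi fun _ => P)) :
      AEMeasurable (fun ω => ‖g (h fun i => W i ω) - θ‖) μ := by
    have hgh := hg.comp_measurePreserving hh
    rw [← hW.map_eq] at hgh
    exact ((hgh.comp_aemeasurable hW.aemeasurable).sub aestronglyMeasurable_const).norm.aemeasurable
  exact nullMeasurableSet_le
    ((hnorm measurePreserving_firstHalf hg₁).max (hnorm measurePreserving_secondHalf hg₂))
    aemeasurable_const

theorem eLpNorm_indicator_pilotEvent_le
    (hW : HasLaw (fun ω i => W i ω) (Measure.pi fun _ => P) μ)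
    (hP : AEStronglyMeasurable id P) {g₁ g₂ : (Fin n → B) → B}
    (hg₁ : AEStronglyMeasurable g₁ (Measure.pi fun _ => P))
    (hg₂ : AEStronglyMeasurable g₂ (Measure.pi fun _ => P)) {θ : B} {r : ℝ}
    {H : (Fin n → B) → B → ℝ}
    (hH : ContinuousOn (fun z : (Fin n → B) × B => H z.1 z.2)
      (Set.univ ×ˢ Metric.closedBall θ r)) {p c : ENNReal} (hp1 : 1 ≤ p) (hp : p ≠ ⊤)
    (hc : ∀ t ∈ Metric.closedBall θ r, eLpNorm (fun x => H x t) p (Measure.pi fun _ => P) ≤ c) :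
    AEStronglyMeasurable ((pilotEvent g₁ g₂ W θ r).indicator fun ω =>
        (H (firstHalf fun i => W i ω) (g₂ (secondHalf fun i => W i ω)) +
          H (secondHalf fun i => W i ω) (g₁ (firstHalf fun i => W i ω))) / 2) μ ∧
      eLpNorm ((pilotEvent g₁ g₂ W θ r).indicator fun ω =>
        (H (firstHalf fun i => W i ω) (g₂ (secondHalf fun i => W i ω)) +
          H (secondHalf fun i => W i ω) (g₁ (firstHalf fun i => W i ω))) / 2) p μ ≤ c := by
  have hp0 : p ≠ 0 := (zero_lt_one.trans_le hp1).ne'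
  have hE := nullMeasurableSet_pilotEvent hW hg₁ hg₂ θ r
  have hid := aestronglyMeasurable_id_pi (ι := Fin n) hP
  have hlaw := measurePreserving_halves.comp_hasLaw hW
  have hlaw_swap := Measure.measurePreserving_swap.comp_hasLaw hlaw
  obtain ⟨hm₂, hle₂⟩ := eLpNorm_indicator_independent_pilot_le hp0 hp hlaw hid hg₂
    Metric.isClosed_closedBall hH hc hE
    fun ω hω => mem_closedBall_iff_norm.2 ((le_max_right _ _).trans hω)
  obtain ⟨hm₁, hle₁⟩ := eLpNorm_indicator_independent_pilot_le hp0 hp hlaw_swap hid hg₁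
    Metric.isClosed_closedBall hH hc hE
    fun ω hω => mem_closedBall_iff_norm.2 ((le_max_left _ _).trans hω)
  have hsplit : ((pilotEvent g₁ g₂ W θ r).indicator fun ω =>
        (H (firstHalf fun i => W i ω) (g₂ (secondHalf fun i => W i ω)) +
          H (secondHalf fun i => W i ω) (g₁ (firstHalf fun i => W i ω))) / 2) =
      (2⁻¹ : ℝ) •
        (((pilotEvent g₁ g₂ W θ r).indicator fun ω =>
          H (firstHalf fun i => W i ω) (g₂ (secondHalf fun i => W i ω))) +
        (pilotEvent g₁ g₂ W θ r).indicator fun ω =>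
          H (secondHalf fun i => W i ω) (g₁ (firstHalf fun i => W i ω))) := by
    rw [← Set.indicator_add']
    exact (Set.indicator_congr fun ω _ => div_eq_inv_mul _ _).trans
      (Set.indicator_const_smul _ (2⁻¹ : ℝ) _)
  rw [hsplit]
  exact ⟨(hm₂.add hm₁).const_smul _, eLpNorm_half_add_le hp1 hm₂ hm₁ hle₂ hle₁⟩

variable [NormedSpace ℝ B] [CompleteSpace B] {f : B → ℝ} {g₁ g₂ : (Fin n → B) → B} {α R K r : ℝ}

theorem eLpNorm_crossFit_truncLevel_sub_linearization_le (hn : n ≠ 0) (hP : MemLp id 2 P)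
    (hW : HasLaw (fun ω i => W i ω) (Measure.pi fun _ => P) μ)
    (hg₁ : AEStronglyMeasurable g₁ (Measure.pi fun _ => P))
    (hg₂ : AEStronglyMeasurable g₂ (Measure.pi fun _ => P))
    (hf : ∀ x ∈ Metric.closedBall (mean P) r, IsGevreyAt α R K f x) (hα : 1 ≤ α) (hR : 0 ≤ R)
    (hr : 0 < r) (hRr : R * r * Real.log (Real.exp 1 * n) ^ (α - 1) ≤ (Real.exp 1)⁻¹)
    (hRV : R * Real.log (Real.exp 1 * n) ^ α * √(strongVar P / n) ≤ (Real.exp 1)⁻¹) :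
    let D := (pilotEvent g₁ g₂ W (mean P) r).indicator fun ω =>
      crossFit f (truncLevel n) g₁ g₂ (fun i => W i ω) - f (mean P) -
        fderiv ℝ f (mean P) (sampleMean (fun i => W i ω) - mean P)
    AEStronglyMeasurable D μ ∧
      eLpNorm D 2 μ ≤ ENNReal.ofReal (K * 2 ^ (α - 1) * (R * r / n +
        6 * R * (√(weakVar P) / √n) / (n : ℝ) ^ (3 / 4 : ℝ) +
        28 * R ^ 2 * (√(weakVar P) * √(strongVar P) / n))) := by
  simp only [crossFit_sub_linearization_eq]
  refine eLpNorm_indicator_pilotEvent_le (H := fun x t => oneSided f (truncLevel n) x t -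
      f (mean P) - fderiv ℝ f (mean P) (sampleMean x - mean P)) hW hP.aestronglyMeasurable hg₁ hg₂
    ?_ one_le_two ENNReal.ofNat_ne_top fun t ht =>
      eLpNorm_oneSided_truncLevel_sub_linearization_le hn hP hf hα hR hr ht hRr hRV
  have hcont := continuousOn_oneSided (n := n) (truncLevel n) fun t ht =>
    (hf t ht).contDiffAt.of_le (by exact_mod_cast le_top)
  refine (hcont.sub continuousOn_const).sub (Continuous.continuousOn ?_)
  exact (fderiv ℝ f (mean P)).continuous.comp
    ((continuous_sampleMean.comp continuous_fst).sub continuous_const)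

end CrossFitting

section Rates

variable {α R K r ν V : ℝ} {n : ℕ}

lemma mul_sqrt_strongVar_div_sqrt_le (hn : n ≠ 0) (hα : 0 ≤ α) (hR : 0 ≤ R)
    (hRV : R * Real.log (Real.exp 1 * n) ^ α * √(V / n) ≤ (Real.exp 1)⁻¹) :
    R * (√V / √n) ≤ 2 / 5 := by
  rw [← Real.sqrt_div' V n.cast_nonneg]
  have hlog : 1 ≤ Real.log (Real.exp 1 * n) ^ α := Real.one_le_rpow (one_le_log_exp_one_mul hn) hα
  calc R * √(V / n) ≤ R * Real.log (Real.exp 1 * n) ^ α * √(V / n) :=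
        mul_le_mul_of_nonneg_right (le_mul_of_one_le_right hR hlog) (by positivity)
    _ ≤ (Real.exp 1)⁻¹ := hRV
    _ ≤ 2 / 5 := inv_le_of_inv_le₀ (by norm_num) (by linarith [Real.exp_one_gt_d9])

lemma linearization_rate_add_le (hn : n ≠ 0) (hα : 0 ≤ α) (hR : 0 ≤ R) (hK : 0 ≤ K) (hr : 0 ≤ r)
    (hRV : R * (√V / √n) ≤ 2 / 5) :
    K * 2 ^ (α - 1) * (R * r / n + 6 * R * (√ν / √n) / (n : ℝ) ^ (3 / 4 : ℝ) +
        28 * R ^ 2 * (√ν * √V / n)) + K * R * (√ν / √n) ≤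
      21 * 2 ^ α * max R (R ^ 2) * K * (√(ν / n) + r / n) := by
  have hn0 : (0 : ℝ) < n := by exact_mod_cast hn.bot_lt
  have hone : (1 : ℝ) ≤ (n : ℝ) ^ (3 / 4 : ℝ) :=
    Real.one_le_rpow (by exact_mod_cast hn.bot_lt) (by norm_num)
  have hp : (1 : ℝ) ≤ 2 ^ α := Real.one_le_rpow one_le_two hα
  have hslope : 6 * R * (√ν / √n) / (n : ℝ) ^ (3 / 4 : ℝ) ≤ 6 * R * (√ν / √n) :=
    div_le_self (by positivity) hone
  have hquadratic : 28 * R ^ 2 * (√ν * √V / n) ≤ 12 * R * (√ν / √n) := by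
    calc 28 * R ^ 2 * (√ν * √V / n) = 28 * R * (√ν / √n) * (R * (√V / √n)) := by
          field_simp
          rw [Real.sq_sqrt hn0.le]
      _ ≤ 28 * R * (√ν / √n) * (2 / 5) := by gcongr
      _ ≤ 12 * R * (√ν / √n) := by nlinarith [show 0 ≤ R * (√ν / √n) by positivity]
  rw [Real.sqrt_div' ν n.cast_nonneg, Real.rpow_sub_one two_ne_zero]
  calc K * (2 ^ α / 2) * (R * r / n + 6 * R * (√ν / √n) / (n : ℝ) ^ (3 / 4 : ℝ) +
        28 * R ^ 2 * (√ν * √V / n)) + K * R * (√ν / √n)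
      ≤ K * (2 ^ α / 2) * (R * r / n + 6 * R * (√ν / √n) + 12 * R * (√ν / √n)) +
        K * R * (√ν / √n) * 2 ^ α :=
        add_le_add (by gcongr) (le_mul_of_one_le_right (by positivity) hp)
    _ = 2 ^ α * R * K * (10 * (√ν / √n) + 1 / 2 * (r / n)) := by ring
    _ ≤ 2 ^ α * max R (R ^ 2) * K * (21 * (√ν / √n) + 21 * (r / n)) := by
        gcongr <;> first | exact le_max_left _ _ | norm_num
    _ = _ := by ring

lemma sqrt_two_mul_linearization_rate_le (hn : n ≠ 0) (hR : 0 ≤ R) (hK : 0 ≤ K) (hr : 0 ≤ r)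
    (hν : 0 ≤ ν) :
    √(2 * n : ℝ) * (K * 2 ^ (α - 1) * (R * r / n + 6 * R * (√ν / √n) / (n : ℝ) ^ (3 / 4 : ℝ) +
        28 * R ^ 2 * (√ν * √V / n))) ≤
      21 * 2 ^ α * max R (R ^ 2) * K *
        (√(ν * V / n) + r / √n + √ν / (n : ℝ) ^ (3 / 4 : ℝ)) := by
  have : (0 : ℝ) < n := by exact_mod_cast hn.bot_lt
  have hsqrt_two : √(2 : ℝ) ≤ 3 / 2 := (Real.sqrt_le_left (by norm_num)).2 (by norm_num)
  have hsqrt_div : √(n : ℝ) / n = 1 / √n := by rw [Real.sqrt_div_self']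
  rw [Real.sqrt_mul zero_le_two, Real.sqrt_div' (ν * V) n.cast_nonneg, Real.sqrt_mul hν,
    Real.rpow_sub_one two_ne_zero]
  calc √2 * √n * (K * (2 ^ α / 2) * (R * r / n + 6 * R * (√ν / √n) / (n : ℝ) ^ (3 / 4 : ℝ) +
        28 * R ^ 2 * (√ν * √V / n)))
      = √2 * (2 ^ α * K * (R * (1 / 2 * (r * (√n / n))) +
        R * (3 * (√ν / (n : ℝ) ^ (3 / 4 : ℝ))) + R ^ 2 * (14 * (√ν * √V * (√n / n))))) := by
        field_simp
        ring
    _ ≤ 3 / 2 * (2 ^ α * K * (max R (R ^ 2) * (14 * (r * (√n / n))) +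
        max R (R ^ 2) * (14 * (√ν / (n : ℝ) ^ (3 / 4 : ℝ))) +
        max R (R ^ 2) * (14 * (√ν * √V * (√n / n))))) := by
        gcongr <;> first | exact le_max_left _ _ | exact le_max_right _ _ | norm_num
    _ = _ := by
        rw [hsqrt_div]
        ring

end Rates

section CrossFittedRisk

variable {B : Type*} [NormedAddCommGroup B] [NormedSpace ℝ B] [CompleteSpace B]

variable [MeasurableSpace B] {P : Measure B} [IsProbabilityMeasure P]
  {Ω : Type*} [MeasurableSpace Ω] {μ : Measure Ω} {n : ℕ} {W : Fin (n + n) → Ω → B}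
  {f : B → ℝ} {g₁ g₂ : (Fin n → B) → B} {α R K r : ℝ}

lemma eLpNorm_indicator_dual_sampleMean_le {N : ℕ} {W : Fin N → Ω → B} (hN : N ≠ 0)
    (hP : MemLp id 2 P) (hW : HasLaw (fun ω i => W i ω) (Measure.pi fun _ => P) μ) {S : Set Ω}
    (hS : NullMeasurableSet S μ) (u : StrongDual ℝ B) :
    AEStronglyMeasurable (S.indicator fun ω => u (sampleMean (fun i => W i ω) - mean P)) μ ∧
      eLpNorm (S.indicator fun ω => u (sampleMean (fun i => W i ω) - mean P)) 2 μ ≤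
        ENNReal.ofReal (‖u‖ * (√(weakVar P) / √N)) := by
  have hcont : Continuous fun w : Fin N → B => u (sampleMean w - mean P) :=
    u.continuous.comp (continuous_sampleMean.sub continuous_const)
  have hm := hcont.comp_aestronglyMeasurable
    (aestronglyMeasurable_id_pi (ι := Fin N) hP.aestronglyMeasurable)
  have hle := eLpNorm_dual_sampleMean_sub_mean_le hN hP u
  rw [← hW.map_eq] at hm hle
  refine ⟨(hm.comp_aemeasurable hW.aemeasurable).indicator₀ hS, (eLpNorm_indicator_le _).trans ?_⟩
  exact (eLpNorm_map_measure hm hW.aemeasurable).symm.trans_le hle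

theorem integrable_and_sqrt_integral_crossFit_sub_sq_le (hn : n ≠ 0) (hP : MemLp id 2 P)
    (hW : HasLaw (fun ω i => W i ω) (Measure.pi fun _ => P) μ)
    (hg₁ : AEStronglyMeasurable g₁ (Measure.pi fun _ => P))
    (hg₂ : AEStronglyMeasurable g₂ (Measure.pi fun _ => P))
    (hf : ∀ x ∈ Metric.closedBall (mean P) r, IsGevreyAt α R K f x) (hα : 1 ≤ α) (hR : 0 ≤ R)
    (hr : 0 < r) (hRr : R * r * Real.log (Real.exp 1 * n) ^ (α - 1) ≤ (Real.exp 1)⁻¹)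
    (hRV : R * Real.log (Real.exp 1 * n) ^ α * √(strongVar P / n) ≤ (Real.exp 1)⁻¹) :
    let err := (pilotEvent g₁ g₂ W (mean P) r).indicator fun ω =>
      |crossFit f (truncLevel n) g₁ g₂ (fun i => W i ω) - f (mean P)| ^ 2
    Integrable err μ ∧ √(∫ ω, err ω ∂μ) ≤
      21 * 2 ^ α * max R (R ^ 2) * K * (√(weakVar P / n) + r / n) := by
  intro err
  have hθ := hf (mean P) (Metric.mem_closedBall_self hr.le)
  have hK := hθ.nonneg
  obtain ⟨hDm, hDle⟩ :=
    eLpNorm_crossFit_truncLevel_sub_linearization_le hn hP hW hg₁ hg₂ hf hα hR hr hRr hRV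
  obtain ⟨hLm, hLle⟩ := eLpNorm_indicator_dual_sampleMean_le (by omega) hP hW
    (nullMeasurableSet_pilotEvent hW hg₁ hg₂ (mean P) r) (fderiv ℝ f (mean P))
  have herr : err = fun ω => ((pilotEvent g₁ g₂ W (mean P) r).indicator (fun ω =>
      crossFit f (truncLevel n) g₁ g₂ (fun i => W i ω) - f (mean P) -
        fderiv ℝ f (mean P) (sampleMean (fun i => W i ω) - mean P)) ω +
      (pilotEvent g₁ g₂ W (mean P) r).indicator (fun ω =>
        fderiv ℝ f (mean P) (sampleMean (fun i => W i ω) - mean P)) ω) ^ 2 := by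
    ext ω
    by_cases hω : ω ∈ pilotEvent g₁ g₂ W (mean P) r <;> simp [err, hω]
  have hlinear : ‖fderiv ℝ f (mean P)‖ * (√(weakVar P) / √(n + n : ℕ)) ≤
      K * R * (√(weakVar P) / √n) := by
    gcongr
    · exact hθ.norm_fderiv_le
    · omega
  rw [herr]
  exact integrable_sq_and_sqrt_integral_le (hDm.add hLm) (by positivity)
    ((eLpNorm_add_le_ofReal_add (by positivity) (by positivity) hDm hLm hDle hLle).trans
      (ENNReal.ofReal_le_ofReal ((add_le_add_right hlinear _).trans
        (linearization_rate_add_le hn (by linarith) hR hK hr.le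
          (mul_sqrt_strongVar_div_sqrt_le hn (by linarith) hR hRV)))))

theorem integrable_and_sqrt_integral_crossFit_sub_linearization_sq_le (hn : n ≠ 0)
    (hP : MemLp id 2 P) (hW : HasLaw (fun ω i => W i ω) (Measure.pi fun _ => P) μ)
    (hg₁ : AEStronglyMeasurable g₁ (Measure.pi fun _ => P))
    (hg₂ : AEStronglyMeasurable g₂ (Measure.pi fun _ => P))
    (hf : ∀ x ∈ Metric.closedBall (mean P) r, IsGevreyAt α R K f x) (hα : 1 ≤ α) (hR : 0 ≤ R)
    (hr : 0 < r) (hRr : R * r * Real.log (Real.exp 1 * n) ^ (α - 1) ≤ (Real.exp 1)⁻¹)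
    (hRV : R * Real.log (Real.exp 1 * n) ^ α * √(strongVar P / n) ≤ (Real.exp 1)⁻¹) :
    let dev := (pilotEvent g₁ g₂ W (mean P) r).indicator fun ω => (2 * n : ℝ) *
      (crossFit f (truncLevel n) g₁ g₂ (fun i => W i ω) - f (mean P) -
        fderiv ℝ f (mean P) (sampleMean (fun i => W i ω) - mean P)) ^ 2
    Integrable dev μ ∧ √(∫ ω, dev ω ∂μ) ≤ 21 * 2 ^ α * max R (R ^ 2) * K *
      (√(weakVar P * strongVar P / n) + r / √n + √(weakVar P) / (n : ℝ) ^ (3 / 4 : ℝ)) := by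
  intro dev
  have hK := (hf (mean P) (Metric.mem_closedBall_self hr.le)).nonneg
  obtain ⟨hDm, hDle⟩ :=
    eLpNorm_crossFit_truncLevel_sub_linearization_le hn hP hW hg₁ hg₂ hf hα hR hr hRr hRV
  have hdev : dev = fun ω => (√(2 * n : ℝ) • (pilotEvent g₁ g₂ W (mean P) r).indicator (fun ω =>
      crossFit f (truncLevel n) g₁ g₂ (fun i => W i ω) - f (mean P) -
        fderiv ℝ f (mean P) (sampleMean (fun i => W i ω) - mean P))) ω ^ 2 := by
    ext ω
    by_cases hω : ω ∈ pilotEvent g₁ g₂ W (mean P) r <;> simp [dev, hω, mul_pow]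
  rw [hdev]
  refine integrable_sq_and_sqrt_integral_le (hDm.const_smul _) (by positivity) ?_
  rw [eLpNorm_const_smul, Real.enorm_eq_ofReal (Real.sqrt_nonneg _)]
  calc _ ≤ ENNReal.ofReal √(2 * n : ℝ) * ENNReal.ofReal _ := by gcongr
    _ = ENNReal.ofReal (√(2 * n : ℝ) * _) := (ENNReal.ofReal_mul (Real.sqrt_nonneg _)).symm
    _ ≤ _ := ENNReal.ofReal_le_ofReal
        (sqrt_two_mul_linearization_rate_le hn hR hK hr.le (weakVar_nonneg P))

end CrossFittedRisk

end GevreyEst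

theorem mainTheorem4 :
    ∃ C : ℝ, 0 < C ∧
      ∀ (B : Type*) [NormedAddCommGroup B] [NormedSpace ℝ B] [CompleteSpace B]
        [MeasurableSpace B] [BorelSpace B]
        (Ω : Type*) [MeasurableSpace Ω] (μ : Measure Ω) [IsProbabilityMeasure μ]
        (P : Measure B) [IsProbabilityMeasure P] (_ : MemLp (fun w : B => w) 2 P)
        (n : ℕ) (_ : 1 ≤ n)
        (W : Fin (n + n) → Ω → B) (_ : ∀ i, HasLaw (W i) P μ) (_ : iIndepFun W μ)
        (g₁ g₂ : (Fin n → B) → B)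
        (_ : AEStronglyMeasurable g₁ (Measure.pi fun _ : Fin n => P))
        (_ : AEStronglyMeasurable g₂ (Measure.pi fun _ : Fin n => P))
        (α R r : ℝ) (_ : 1 ≤ α) (_ : 0 < R) (_ : 0 < r)
        (U : Set B) (_ : Metric.closedBall (GevreyEst.mean P) r ⊆ U)
        (f : B → ℝ) (_ : f ∈ GevreyEst.gevreyClass α U)
        (_ : GevreyEst.gevreyNorm α R U f < ⊤)
        (_ : max (R * r * Real.log (Real.exp 1 * n) ^ (α - 1))
            (R * Real.log (Real.exp 1 * n) ^ α * √(GevreyEst.strongVar P / n))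
            ≤ (Real.exp 1)⁻¹),
        let θ : B := GevreyEst.mean P
        let ν : ℝ := GevreyEst.weakVar P
        let V : ℝ := GevreyEst.strongVar P
        let F : ℝ := (GevreyEst.gevreyNorm α R U f).toReal
        let E : Set Ω := GevreyEst.pilotEvent g₁ g₂ W θ r
        let fhat : Ω → ℝ := fun ω =>
          GevreyEst.crossFit f (GevreyEst.truncLevel n) g₁ g₂ (fun i => W i ω)
        let err : Ω → ℝ := E.indicator fun ω => |fhat ω - f θ| ^ 2
        let dev : Ω → ℝ := E.indicator fun ω => (2 * n : ℝ) *
          (fhat ω - f θ - fderiv ℝ f θ (GevreyEst.sampleMean (fun i => W i ω) - θ)) ^ 2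
        (Integrable err μ ∧
          √(∫ ω, err ω ∂μ) ≤ C * 2 ^ α * max R (R ^ 2) * F * (√(ν / n) + r / n)) ∧
        (Integrable dev μ ∧
          √(∫ ω, dev ω ∂μ) ≤ C * 2 ^ α * max R (R ^ 2) * F *
            (√(ν * V / n) + r / √n + √ν / (n : ℝ) ^ (3 / 4 : ℝ))) := by
  refine ⟨21, by norm_num, ?_⟩
  intro B _ _ _ _ _ Ω _ μ _ P _ hP n hn W hW hind g₁ g₂ hg₁ hg₂ α R r hα hR hr U hU f hf hfin
    hregime θ ν V F E fhat err dev
  obtain ⟨hRr, hRV⟩ := max_le_iff.1 hregime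
  have hn0 : n ≠ 0 := by omega
  have hsample : HasLaw (fun ω i => W i ω) (Measure.pi fun _ => P) μ := hind.hasLaw_pi hW
  have hgevrey : ∀ x ∈ Metric.closedBall θ r, GevreyEst.IsGevreyAt α R F f x := fun x hx =>
    GevreyEst.isGevreyAt_of_gevreyNorm_lt_top hR hf.1 hfin (hU hx)
  exact ⟨GevreyEst.integrable_and_sqrt_integral_crossFit_sub_sq_le hn0 hP hsample hg₁ hg₂ hgevrey
      hα hR.le hr hRr hRV,
    GevreyEst.integrable_and_sqrt_integral_crossFit_sub_linearization_sq_le hn0 hP hsample hg₁ hg₂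
      hgevrey hα hR.le hr hRr hRV⟩
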